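/- Let $A$ be a finite discrete alphabet and let $X \subseteq A^{\mathbb Z}$ be an infinite minimal subshift, i.e. $X$ is an infinite closed set with $\sigma(X) = X$, where $\sigma(x)_i = x_{i+1}$, and every shift orbit $\mathcal O(x) = \{\sigma^n(x) \mid n \in \mathbb Z\}$, $x \in X$, is dense in $X$. Let $[[\sigma]]$ be the topological full group of $X$: the group, under composition, of all homeomorphisms $f : X \to X$ for which there is a continuous function $n : X \to \mathbb Z$ with $f(x) = \sigma^{n(x)}(x)$ for all $x \in X$. Then: 1. For every $x \in X$ the orbit $\mathcal O(x)$ is countable and $f(\mathcal O(x)) = \mathcal O(x)$ for all $f \in [[\sigma]]$, so that $[[\sigma]]$ acts on $\mathcal O(x)$. 2. The commutator subgroup $D = [\,[[\sigma]], [[\sigma]]\,]$ is finitely generated. 3. $D$ acts $\infty$-transitively on every shift orbit: for every $x \in X$, every $k \in \mathbb N$, and all $k$-tuples $(y_1, \ldots, y_k)$ and $(z_1, \ldots, z_k)$ of pairwise distinct points of $\mathcal O(x)$, there is $g \in D$ with $g(y_i) = z_i$ for all $i \in \{1, \ldots, k\}$. -/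

import Mathlib

open SymbolicDynamics.FullShift

/-- The shift action of `ℤ` on a two-sided subshift: `n` acts as `σ ^ n`, that is,
`(n +ᵥ x) i = x (n + i)`. -/
instance subshiftAddAction {A : Type*} [TopologicalSpace A] (X : Subshift A ℤ) :
    AddAction ℤ X.carrier where
  vadd n x := ⟨shift n x.1, X.mapsTo n x.2⟩
  zero_vadd x := by
    apply Subtype.ext
    funext i
    change x.1 (0 + i) = x.1 i
    rw [zero_add]
  add_vadd m n x := by
    apply Subtype.ext
    funext i
    change x.1 (m + n + i) = x.1 (n + (m + i))
    rw [add_comm m n, add_assoc, add_left_comm]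

theorem subshift_vadd_apply {A : Type*} [TopologicalSpace A] (X : Subshift A ℤ)
    (n : ℤ) (x : X.carrier) (i : ℤ) : (n +ᵥ x).1 i = x.1 (n + i) := rfl

/-- The topological full group of a subshift `X`: all homeomorphisms `f : X → X` such that
`f x = σ ^ n(x) (x)` for some continuous function `n : X → ℤ` (`ℤ` being discrete). -/
def topologicalFullGroup {A : Type*} [TopologicalSpace A] (X : Subshift A ℤ) :
    Subgroup (X.carrier ≃ₜ X.carrier) where
  carrier := {f | ∃ n : X.carrier → ℤ, Continuous n ∧ ∀ x, f x = n x +ᵥ x}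
  one_mem' := ⟨fun _ => 0, continuous_const, fun x => (zero_vadd ℤ x).symm⟩
  mul_mem' := by
    rintro f g ⟨m, hm, hf⟩ ⟨n, hn, hg⟩
    refine ⟨fun x => m (g x) + n x, (hm.comp g.continuous).add hn, fun x => ?_⟩
    rw [Homeomorph.mul_apply, hf, add_vadd, ← hg]
  inv_mem' := by
    rintro f ⟨n, hn, hf⟩
    refine ⟨fun x => -n (f.symm x), (hn.comp f.symm.continuous).neg, fun x => ?_⟩
    have h := hf (f.symm x)
    rw [Homeomorph.apply_symm_apply] at h
    rw [Homeomorph.inv_apply, eq_neg_vadd_iff, ← h]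

theorem topologicalFullGroup_apply_mem_orbit {A : Type*} [TopologicalSpace A]
    (X : Subshift A ℤ) {f : X.carrier ≃ₜ X.carrier} (hf : f ∈ topologicalFullGroup X)
    (x : X.carrier) {y : X.carrier} (hy : y ∈ AddAction.orbit ℤ x) :
    f y ∈ AddAction.orbit ℤ x := by
  obtain ⟨n, -, hn⟩ := hf
  rw [hn y]
  exact AddAction.mem_orbit_of_mem_orbit (n y) hy

/-- The natural action of the topological full group on the shift orbit of a point. -/
instance topologicalFullGroupOrbitAction {A : Type*} [TopologicalSpace A]
    (X : Subshift A ℤ) (x : X.carrier) :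
    MulAction (topologicalFullGroup X) (AddAction.orbit ℤ x) where
  smul f y := ⟨f.1 y.1, topologicalFullGroup_apply_mem_orbit X f.2 x y.2⟩
  one_smul _ := rfl
  mul_smul _ _ _ := rfl

theorem topologicalFullGroup_smul_coe {A : Type*} [TopologicalSpace A] (X : Subshift A ℤ)
    (x : X.carrier) (f : topologicalFullGroup X) (y : AddAction.orbit ℤ x) :
    ((f • y : AddAction.orbit ℤ x) : X.carrier) = f.1 y.1 := rfl

/-! If the first `n` translates of a clopen set are disjoint, the symmetric group of degree `n` acts
on this tower by locally constant powers of the shift. An infinite minimal subshift has no periodic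
points, so by compactness every cylinder over a long enough window is the base of a tower of any
prescribed height. For `n ≥ 5` the commutator subgroup of the symmetric group is the alternating
group, so even permutations of tall towers lie in the commutator subgroup `D`. This gives
transitivity: finitely many points of one orbit are levels of a single tower, and spare levels
correct the parity.

For finite generation, recode by blocks so that any five consecutive letters are distinct. Then `D ≤
altFullGroup X ≤ atomGroup w ≤ D`, where `altFullGroup X` is generated by all even multisection
permutations, and `atomGroup w` by the finitely many alternating groups of degree five over
cylinders of length two.

The first inclusion (`commutator_le_altFullGroup`) is a displacement argument: modulo the normal
subgroup `altFullGroup X`, any two elements can be represented by elements with disjoint supports.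
The second (`altFullGroup_le_atomGroup`) cuts a multisection into towers over long cylinders and
reaches these from short ones, since a commutator over two bases lives over their intersection
(`towerHom_inter_mem`); simplicity of the alternating group of degree five does the rest. The third
(`towerHom_mem_commutator`) is again the perfectness statement. -/

open Equiv Filter Topology

/-! ### The topological full group of an abstract `ℤ`-action -/

section FullGroup

variable (X : Type*) [TopologicalSpace X] [AddAction ℤ X]

/-- The topological full group of a `ℤ`-action on a space: all homeomorphisms that are locally
given by elements of `ℤ`. -/
def fullGroup : Subgroup (X ≃ₜ X) where
  carrier := {f | ∃ n : X → ℤ, Continuous n ∧ ∀ x, f x = n x +ᵥ x}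
  one_mem' := ⟨fun _ => 0, continuous_const, fun x => (zero_vadd ℤ x).symm⟩
  mul_mem' := by
    rintro f g ⟨m, hm, hf⟩ ⟨n, hn, hg⟩
    refine ⟨fun x => m (g x) + n x, (hm.comp g.continuous).add hn, fun x => ?_⟩
    rw [Homeomorph.mul_apply, hf, add_vadd, ← hg]
  inv_mem' := by
    rintro f ⟨n, hn, hf⟩
    refine ⟨fun x => -n (f.symm x), (hn.comp f.symm.continuous).neg, fun x => ?_⟩
    have h := hf (f.symm x)
    rw [Homeomorph.apply_symm_apply] at h
    rw [Homeomorph.inv_apply, eq_neg_vadd_iff, ← h]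

variable {X}

theorem fullGroup_ext {f g : fullGroup X} (h : ∀ x, f.1 x = g.1 x) : f = g :=
  Subtype.ext (Homeomorph.ext h)

theorem fullGroup_mul_apply (f g : fullGroup X) (x : X) : (f * g).1 x = f.1 (g.1 x) := rfl

theorem fullGroup_inv_apply_apply (f : fullGroup X) (x : X) : (f⁻¹).1 (f.1 x) = x :=
  f.1.symm_apply_apply x

theorem fullGroup_apply_inv_apply (f : fullGroup X) (x : X) : f.1 ((f⁻¹).1 x) = x :=
  f.1.apply_symm_apply x

theorem fullGroup_exists_cocycle (f : fullGroup X) :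
    ∃ n : X → ℤ, IsLocallyConstant n ∧ ∀ x, f.1 x = n x +ᵥ x := by
  obtain ⟨n, hn, h⟩ := f.2
  exact ⟨n, (IsLocallyConstant.iff_continuous n).2 hn, h⟩

theorem continuous_locallyConstant_vadd [ContinuousConstVAdd ℤ X] {n : X → ℤ}
    (hn : IsLocallyConstant n) : Continuous fun x => n x +ᵥ x := by
  rw [continuous_iff_continuousAt]
  intro x
  have h : (fun y => n y +ᵥ y) =ᶠ[𝓝 x] fun y => n x +ᵥ y := by
    filter_upwards [hn.eventually_eq x] with y hy
    rw [hy]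
  exact (continuous_const_vadd (n x)).continuousAt.congr h.symm

/-- The element of the full group given by two locally constant cocycles inverse to one another. -/
def fullGroupMk [ContinuousConstVAdd ℤ X] (m n : X → ℤ) (hm : IsLocallyConstant m)
    (hn : IsLocallyConstant n) (hl : ∀ x, n (m x +ᵥ x) +ᵥ (m x +ᵥ x) = x)
    (hr : ∀ x, m (n x +ᵥ x) +ᵥ (n x +ᵥ x) = x) : fullGroup X :=
  ⟨{ toFun := fun x => m x +ᵥ x
     invFun := fun x => n x +ᵥ x
     left_inv := hl
     right_inv := hr
     continuous_toFun := continuous_locallyConstant_vadd hm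
     continuous_invFun := continuous_locallyConstant_vadd hn },
    m, hm.continuous, fun _ => rfl⟩

end FullGroup

/-! ### Multisections and their groups of permutations -/

/-- A multisection: over each point `x` there is a set of active indices, and the index `i` stands
for the point `pos x i +ᵥ x`; distinct pairs of a point and an active index over it stand for
distinct points. -/
structure Multisection (X : Type*) [TopologicalSpace X] [AddAction ℤ X] (ι : Type*) where
  /-- The active indices. -/
  active : X → Set ι
  /-- The position of an index. -/
  pos : X → ι → ℤ
  isLocallyConstant_active : IsLocallyConstant active
  isLocallyConstant_pos : IsLocallyConstant pos
  inj : ∀ {x y i j}, i ∈ active x → j ∈ active y → pos x i +ᵥ x = pos y j +ᵥ y → x = y ∧ i = j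

namespace Multisection

variable {X : Type*} [TopologicalSpace X] [AddAction ℤ X] {ι : Type*} (m : Multisection X ι)

/-- The locally constant families of permutations of the active indices. -/
def perms : Subgroup (X → Perm ι) where
  carrier := {p | IsLocallyConstant p ∧ ∀ x, ∀ i ∉ m.active x, p x i = i}
  one_mem' := ⟨IsLocallyConstant.const 1, fun _ _ _ => rfl⟩
  mul_mem' := by
    rintro p q ⟨hp, hp'⟩ ⟨hq, hq'⟩
    refine ⟨hp.mul hq, fun x i hi => ?_⟩
    rw [Pi.mul_apply, Perm.mul_apply, hq' x i hi, hp' x i hi]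
  inv_mem' := by
    rintro p ⟨hp, hp'⟩
    refine ⟨hp.inv, fun x i hi => ?_⟩
    rw [Pi.inv_apply, Perm.inv_eq_iff_eq, hp' x i hi]

variable {m}

theorem perms_apply_mem {p : X → Perm ι} (hp : p ∈ m.perms) {x : X} {i : ι} (hi : i ∈ m.active x) :
    p x i ∈ m.active x := by
  by_contra h
  have := (p x).injective (hp.2 x _ h)
  rw [this] at h
  exact h hi

open Classical in
/-- The cocycle of the homeomorphism given by a family of permutations of the active indices. -/
noncomputable def cocycle (m : Multisection X ι) (p : X → Perm ι) (z : X) : ℤ :=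
  if h : ∃ q : X × ι, q.2 ∈ m.active q.1 ∧ m.pos q.1 q.2 +ᵥ q.1 = z then
    m.pos h.choose.1 (p h.choose.1 h.choose.2) - m.pos h.choose.1 h.choose.2 else 0

theorem cocycle_apply (p : X → Perm ι) {x : X} {i : ι} (hi : i ∈ m.active x) :
    m.cocycle p (m.pos x i +ᵥ x) = m.pos x (p x i) - m.pos x i := by
  have h : ∃ q : X × ι, q.2 ∈ m.active q.1 ∧ m.pos q.1 q.2 +ᵥ q.1 = m.pos x i +ᵥ x :=
    ⟨(x, i), hi, rfl⟩
  -- Injectivity makes the chosen pair the given one, so the choice in `cocycle` is immaterial.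
  obtain ⟨h1, h2⟩ := m.inj h.choose_spec.1 hi h.choose_spec.2
  rw [cocycle, dif_pos h, h1, h2]

theorem cocycle_of_forall_ne (p : X → Perm ι) {z : X}
    (hz : ∀ x, ∀ i ∈ m.active x, m.pos x i +ᵥ x ≠ z) : m.cocycle p z = 0 := by
  rw [cocycle, dif_neg]
  rintro ⟨q, hq, hqz⟩
  exact hz _ _ hq hqz

theorem cocycle_vadd (p : X → Perm ι) {x : X} {i : ι} (hi : i ∈ m.active x) :
    m.cocycle p (m.pos x i +ᵥ x) +ᵥ (m.pos x i +ᵥ x) = m.pos x (p x i) +ᵥ x := by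
  rw [cocycle_apply p hi, ← add_vadd, sub_add_cancel]

theorem cocycle_mul {p q : X → Perm ι} (hq : q ∈ m.perms) (z : X) :
    m.cocycle p (m.cocycle q z +ᵥ z) +ᵥ (m.cocycle q z +ᵥ z) = m.cocycle (p * q) z +ᵥ z := by
  by_cases h : ∀ x, ∀ i ∈ m.active x, m.pos x i +ᵥ x ≠ z
  · rw [cocycle_of_forall_ne q h, zero_vadd, cocycle_of_forall_ne p h, cocycle_of_forall_ne _ h]
  · push Not at h
    obtain ⟨x, i, hi, rfl⟩ := h
    rw [cocycle_vadd q hi, cocycle_vadd p (perms_apply_mem hq hi), cocycle_vadd _ hi]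
    rfl

theorem cocycle_one (z : X) : m.cocycle 1 z = 0 := by
  by_cases h : ∀ x, ∀ i ∈ m.active x, m.pos x i +ᵥ x ≠ z
  · rw [cocycle_of_forall_ne _ h]
  · push Not at h
    obtain ⟨x, i, hi, rfl⟩ := h
    rw [cocycle_apply _ hi]
    exact sub_self _

variable (m) in
theorem exists_pos_bound [CompactSpace X] [Finite ι] : ∃ L : ℕ, ∀ x i, m.pos x i ∈ Set.Icc (-L : ℤ) L := by
  have h1 : (Set.range fun q : X × ι => (m.pos q.1 q.2).natAbs).Finite := by
    refine ((m.isLocallyConstant_pos.range_finite.prod (Set.finite_univ (α := ι))).image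
      fun q : (ι → ℤ) × ι => (q.1 q.2).natAbs).subset ?_
    rintro _ ⟨q, rfl⟩
    exact ⟨(m.pos q.1, q.2), ⟨⟨_, rfl⟩, trivial⟩, rfl⟩
  obtain ⟨L, hL⟩ := h1.bddAbove
  refine ⟨L, fun x i => ?_⟩
  have : (m.pos x i).natAbs ≤ L := hL ⟨(x, i), rfl⟩
  constructor <;> omega

variable [ContinuousConstVAdd ℤ X] [Finite ι]

/-- The image of a multisection under an element of the full group. -/
def map (m : Multisection X ι) (g : fullGroup X) {n : X → ℤ} (hn : IsLocallyConstant n)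
    (hg : ∀ x, g.1 x = n x +ᵥ x) : Multisection X ι where
  active := m.active
  pos x i := n (m.pos x i +ᵥ x) + m.pos x i
  isLocallyConstant_active := m.isLocallyConstant_active
  isLocallyConstant_pos := by
    rw [IsLocallyConstant.iff_eventually_eq]
    intro x
    have h : ∀ᶠ y in 𝓝 x, ∀ i, n (m.pos x i +ᵥ y) = n (m.pos x i +ᵥ x) := by
      rw [Filter.eventually_all]
      exact fun i => (hn.comp_continuous (continuous_const_vadd (m.pos x i))).eventually_eq x
    filter_upwards [h, m.isLocallyConstant_pos.eventually_eq x] with y h1 h2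
    funext i
    rw [h2, h1]
  inj {x y i j} hi hj h := by
    rw [add_vadd, add_vadd, ← hg, ← hg] at h
    exact m.inj hi hj (g.1.injective h)

theorem map_pos_vadd (g : fullGroup X) {n : X → ℤ} (hn : IsLocallyConstant n)
    (hg : ∀ x, g.1 x = n x +ᵥ x) (x : X) (i : ι) :
    (m.map g hn hg).pos x i +ᵥ x = g.1 (m.pos x i +ᵥ x) := by
  rw [hg, ← add_vadd]
  rfl

variable [CompactSpace X]

/-- Positions are bounded by some `L`, so the value at `z` depends only on the data over the
finitely many points `-k +ᵥ z` with `|k| ≤ L`. -/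
theorem isLocallyConstant_cocycle {p : X → Perm ι} (hp : p ∈ m.perms) :
    IsLocallyConstant (m.cocycle p) := by
  obtain ⟨L, hL⟩ := m.exists_pos_bound
  rw [IsLocallyConstant.iff_eventually_eq]
  intro z
  have h1 : ∀ᶠ y in 𝓝 z, ∀ k ∈ Set.Icc (-L : ℤ) L,
      m.active (-k +ᵥ y) = m.active (-k +ᵥ z) ∧ m.pos (-k +ᵥ y) = m.pos (-k +ᵥ z) ∧
        p (-k +ᵥ y) = p (-k +ᵥ z) := by
    rw [Filter.eventually_all_finite (Set.finite_Icc _ _)]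
    intro k _
    have hk := continuous_const_vadd (T := X) (-k)
    exact ((m.isLocallyConstant_active.comp_continuous hk).eventually_eq z).and
      (((m.isLocallyConstant_pos.comp_continuous hk).eventually_eq z).and
      ((hp.1.comp_continuous hk).eventually_eq z))
  filter_upwards [h1] with y hy
  by_cases h : ∀ x, ∀ i ∈ m.active x, m.pos x i +ᵥ x ≠ z
  · rw [cocycle_of_forall_ne p h, cocycle_of_forall_ne]
    rintro x i hi rfl
    obtain ⟨ha, hb, -⟩ := hy _ (hL x i)
    rw [neg_vadd_vadd] at ha hb
    apply h (-m.pos x i +ᵥ z) i (ha ▸ hi)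
    rw [← hb, vadd_neg_vadd]
  · push Not at h
    obtain ⟨x, i, hi, rfl⟩ := h
    obtain ⟨ha, hb, hc⟩ := hy _ (hL x i)
    rw [neg_vadd_vadd] at ha hb hc
    rw [cocycle_apply p hi]
    have hi' : i ∈ m.active (-m.pos x i +ᵥ y) := by rwa [ha]
    have := cocycle_apply p hi'
    rwa [hb, hc, vadd_neg_vadd] at this

/-- The action of the families of permutations of the active indices. -/
noncomputable def hom (m : Multisection X ι) : m.perms →* fullGroup X where
  toFun p := fullGroupMk (m.cocycle p) (m.cocycle (p⁻¹ : m.perms))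
    (isLocallyConstant_cocycle p.2) (isLocallyConstant_cocycle (p⁻¹).2)
    (fun z => by
      rw [cocycle_mul p.2, ← Subgroup.coe_mul, inv_mul_cancel, Subgroup.coe_one, cocycle_one,
        zero_vadd])
    (fun z => by
      rw [cocycle_mul (p⁻¹).2, ← Subgroup.coe_mul, mul_inv_cancel, Subgroup.coe_one, cocycle_one,
        zero_vadd])
  map_one' := fullGroup_ext fun z => by
    change m.cocycle 1 z +ᵥ z = z
    rw [cocycle_one, zero_vadd]
  map_mul' p q := fullGroup_ext fun z => (cocycle_mul (p := p.1) q.2 z).symm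

theorem hom_apply (p : m.perms) {x : X} {i : ι} (hi : i ∈ m.active x) :
    (m.hom p).1 (m.pos x i +ᵥ x) = m.pos x (p.1 x i) +ᵥ x :=
  cocycle_vadd p.1 hi

theorem hom_apply_of_forall_ne (p : m.perms) {z : X}
    (hz : ∀ x, ∀ i ∈ m.active x, m.pos x i +ᵥ x ≠ z) : (m.hom p).1 z = z := by
  change m.cocycle p z +ᵥ z = z
  rw [cocycle_of_forall_ne _ hz, zero_vadd]

/-- Conjugation moves the multisection and keeps the permutations, hence their signs; this is what
makes `altFullGroup` normal. -/
theorem conj_hom (g : fullGroup X) {n : X → ℤ} (hn : IsLocallyConstant n)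
    (hg : ∀ x, g.1 x = n x +ᵥ x) (p : m.perms) :
    g * m.hom p * g⁻¹ = (m.map g hn hg).hom ⟨p.1, p.2⟩ := by
  refine fullGroup_ext fun z => ?_
  obtain ⟨w, rfl⟩ : ∃ w, g.1 w = z := ⟨_, fullGroup_apply_inv_apply g z⟩
  rw [fullGroup_mul_apply, fullGroup_mul_apply, fullGroup_inv_apply_apply]
  by_cases h : ∀ x, ∀ i ∈ m.active x, m.pos x i +ᵥ x ≠ w
  · rw [hom_apply_of_forall_ne p h, hom_apply_of_forall_ne]
    intro x i hi hx
    rw [map_pos_vadd] at hx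
    exact h x i hi (g.1.injective hx)
  · push Not at h
    obtain ⟨x, i, hi, rfl⟩ := h
    rw [hom_apply p hi, ← map_pos_vadd g hn hg, ← map_pos_vadd g hn hg,
      hom_apply (m := m.map g hn hg) _ hi]

end Multisection

/-! ### The normal subgroup of even multisection permutations -/

section AltSubgroup

variable (X : Type*) [TopologicalSpace X] [AddAction ℤ X] [ContinuousConstVAdd ℤ X] [CompactSpace X]

/-- The subgroup generated by the even permutations of multisections. -/
def altFullGroup : Subgroup (fullGroup X) :=
  Subgroup.closure {f | ∃ (k : ℕ) (m : Multisection X (Fin k)) (p : m.perms),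
    (∀ x, Perm.sign (p.1 x) = 1) ∧ f = m.hom p}

variable {X}

theorem Multisection.hom_mem_altFullGroup {k : ℕ} (m : Multisection X (Fin k)) (p : m.perms)
    (hp : ∀ x, Perm.sign (p.1 x) = 1) : m.hom p ∈ altFullGroup X :=
  Subgroup.subset_closure ⟨k, m, p, hp, rfl⟩

instance altFullGroup_normal : (altFullGroup X).Normal where
  conj_mem f hf g := by
    obtain ⟨n, hn, hg⟩ := fullGroup_exists_cocycle g
    induction hf using Subgroup.closure_induction with
    | mem f hf =>
      obtain ⟨k, m, p, hp, rfl⟩ := hf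
      rw [Multisection.conj_hom g hn hg]
      exact Multisection.hom_mem_altFullGroup _ _ hp
    | one => simp
    | mul a b _ _ ha hb =>
      have : g * (a * b) * g⁻¹ = (g * a * g⁻¹) * (g * b * g⁻¹) := by group
      rw [this]
      exact mul_mem ha hb
    | inv a _ ha =>
      have : g * a⁻¹ * g⁻¹ = (g * a * g⁻¹)⁻¹ := by group
      rw [this]
      exact inv_mem ha

end AltSubgroup

theorem isLocallyConstant_ite {X α : Type*} [TopologicalSpace X] {B : Set X} (hB : IsClopen B)
    [DecidablePred (· ∈ B)] {f g : X → α} (hf : IsLocallyConstant f) (hg : IsLocallyConstant g) :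
    IsLocallyConstant fun x => if x ∈ B then f x else g x := by
  rw [IsLocallyConstant.iff_eventually_eq]
  intro x
  by_cases hx : x ∈ B
  · filter_upwards [hB.isOpen.mem_nhds hx, hf.eventually_eq x] with y hy h
    rw [if_pos hx, if_pos hy, h]
  · filter_upwards [hB.compl.isOpen.mem_nhds hx, hg.eventually_eq x] with y hy h
    rw [if_neg hx, if_neg hy, h]

/-! ### Towers and the symmetric groups acting on them -/

section Tower

variable {X : Type*} [AddAction ℤ X]

/-- The first `n` translates of the set `B` are pairwise disjoint. -/
def IsTower (n : ℕ) (B : Set X) : Prop := ∀ x ∈ B, ∀ i : ℕ, 0 < i → i < n → (i : ℤ) +ᵥ x ∉ B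

theorem IsTower.mono {n : ℕ} {B C : Set X} (h : IsTower n C) (hBC : B ⊆ C) : IsTower n B :=
  fun x hx i h0 hi hB => h x (hBC hx) i h0 hi (hBC hB)

theorem IsTower.of_le {k n : ℕ} {B : Set X} (h : IsTower n B) (hk : k ≤ n) : IsTower k B :=
  fun x hx i h0 hi => h x hx i h0 (hi.trans_le hk)

theorem IsTower.translate {n : ℕ} {B C : Set X} (h : IsTower n B) (s : ℤ)
    (hC : ∀ y, s +ᵥ y ∈ C ↔ y ∈ B) : IsTower n C := by
  intro x hx i h0 hi hxi
  obtain ⟨y, rfl⟩ : ∃ y, s +ᵥ y = x := ⟨-s +ᵥ x, vadd_neg_vadd _ _⟩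
  rw [vadd_comm, hC] at hxi
  exact h y ((hC y).1 hx) i h0 hi hxi

theorem IsTower.eq_of_vadd_eq_aux {n : ℕ} {B : Set X} (h : IsTower n B) {x y : X} (hx : x ∈ B)
    (hy : y ∈ B) {i j : ℕ} (hj : j < n) (hij : i ≤ j) (e : (i : ℤ) +ᵥ x = (j : ℤ) +ᵥ y) :
    x = y ∧ i = j := by
  have e' : x = ((j - i : ℕ) : ℤ) +ᵥ y := by
    rw [← vadd_left_cancel_iff (i : ℤ), e, ← add_vadd]
    congr 1
    omega
  rcases Nat.eq_zero_or_pos (j - i) with h0 | h0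
  · rw [h0, Nat.cast_zero, zero_vadd] at e'
    exact ⟨e', by omega⟩
  · exact absurd (e' ▸ hx) (h y hy _ h0 (by omega))

theorem IsTower.eq_of_vadd_eq {n : ℕ} {B : Set X} (h : IsTower n B) {x y : X} (hx : x ∈ B)
    (hy : y ∈ B) {i j : ℕ} (hi : i < n) (hj : j < n) (e : (i : ℤ) +ᵥ x = (j : ℤ) +ᵥ y) :
    x = y ∧ i = j := by
  rcases le_total i j with hij | hij
  · exact h.eq_of_vadd_eq_aux hx hy hj hij e
  · have := h.eq_of_vadd_eq_aux hy hx hi hij e.symm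
    exact ⟨this.1.symm, this.2.symm⟩

variable [TopologicalSpace X]

/-- The multisection of a tower with base `B` and height `n`. -/
def towerMultisection (n : ℕ) (B : Set X) (h : IsClopen B ∧ IsTower n B) :
    Multisection X (Fin n) where
  active x := {_i | x ∈ B}
  pos _ i := (i : ℕ)
  isLocallyConstant_active := by
    classical
    have := isLocallyConstant_ite h.1 (IsLocallyConstant.const (Set.univ : Set (Fin n)))
      (IsLocallyConstant.const (∅ : Set (Fin n)))
    convert this using 2 with x
    ext i
    by_cases hx : x ∈ B <;> simp [hx]
  isLocallyConstant_pos := IsLocallyConstant.const _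
  inj {x y i j} hx hy e := by
    have := h.2.eq_of_vadd_eq hx hy i.2 j.2 e
    exact ⟨this.1, Fin.ext this.2⟩

open Classical in
/-- The family of permutations of a tower applying the same permutation over each point of the
base. -/
noncomputable def towerPerms (n : ℕ) (B : Set X) (h : IsClopen B ∧ IsTower n B) :
    Perm (Fin n) →* (towerMultisection n B h).perms where
  toFun π := ⟨fun x => if x ∈ B then π else 1,
    isLocallyConstant_ite h.1 (IsLocallyConstant.const π) (IsLocallyConstant.const 1),
    fun x i hx => by
      have hx' : x ∉ B := hx
      simp only [if_neg hx', Perm.one_apply]⟩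
  map_one' := Subtype.ext (funext fun x => ite_self _)
  map_mul' π η := Subtype.ext (funext fun x => by
    change (if x ∈ B then π * η else 1) = (if x ∈ B then π else 1) * (if x ∈ B then η else 1)
    split_ifs <;> simp)

variable [ContinuousConstVAdd ℤ X] [CompactSpace X]

open Classical in
/-- The action of the symmetric group on a tower with base `B` and height `n`. It is trivial if the
first `n` translates of `B` are not disjoint. -/
noncomputable def towerHom (n : ℕ) (B : Set X) : Perm (Fin n) →* fullGroup X :=
  if h : IsClopen B ∧ IsTower n B then (towerMultisection n B h).hom.comp (towerPerms n B h) else 1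

variable {n : ℕ} {B : Set X}

theorem towerHom_apply (hB : IsClopen B) (ht : IsTower n B) (π : Perm (Fin n)) (i : Fin n) {x : X}
    (hx : x ∈ B) : (towerHom n B π).1 (((i : ℕ) : ℤ) +ᵥ x) = ((π i : ℕ) : ℤ) +ᵥ x := by
  rw [towerHom, dif_pos ⟨hB, ht⟩]
  have := Multisection.hom_apply (m := towerMultisection n B ⟨hB, ht⟩)
    (towerPerms n B ⟨hB, ht⟩ π) (i := i) hx
  refine this.trans ?_
  classical
  change (((if x ∈ B then π else 1 : Perm (Fin n)) i : ℕ) : ℤ) +ᵥ x = _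
  rw [if_pos hx]

theorem towerHom_apply_of_forall_ne (π : Perm (Fin n)) {z : X}
    (hz : ∀ x ∈ B, ∀ i : Fin n, ((i : ℕ) : ℤ) +ᵥ x ≠ z) : (towerHom n B π).1 z = z := by
  rw [towerHom]
  split_ifs with h
  · exact Multisection.hom_apply_of_forall_ne _ fun x i hx => hz x hx i
  · rfl

theorem towerHom_eq (hB : IsClopen B) (ht : IsTower n B) (π : Perm (Fin n)) {f : fullGroup X}
    (h1 : ∀ x ∈ B, ∀ i : Fin n, f.1 (((i : ℕ) : ℤ) +ᵥ x) = ((π i : ℕ) : ℤ) +ᵥ x)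
    (h2 : ∀ z, (∀ x ∈ B, ∀ i : Fin n, ((i : ℕ) : ℤ) +ᵥ x ≠ z) → f.1 z = z) :
    f = towerHom n B π := by
  refine fullGroup_ext fun z => ?_
  by_cases hz : ∀ x ∈ B, ∀ i : Fin n, ((i : ℕ) : ℤ) +ᵥ x ≠ z
  · rw [h2 z hz, towerHom_apply_of_forall_ne π hz]
  · push Not at hz
    obtain ⟨x, hx, i, rfl⟩ := hz
    rw [h1 x hx, towerHom_apply hB ht π i hx]

theorem towerHom_mem_altFullGroup {π : Perm (Fin n)} (hπ : Perm.sign π = 1) :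
    towerHom n B π ∈ altFullGroup X := by
  rw [towerHom]
  split_ifs with h
  · refine Multisection.hom_mem_altFullGroup _ _ fun x => ?_
    classical
    change Perm.sign (if x ∈ B then π else 1) = 1
    split_ifs
    · exact hπ
    · exact map_one _
  · exact one_mem _

open Classical in
theorem towerHom_apply_of_subset {S : Set X} (hS : IsTower n S) (hB : IsClopen B) (hBS : B ⊆ S)
    (π : Perm (Fin n)) (i : Fin n) {x : X} (hx : x ∈ S) :
    (towerHom n B π).1 (((i : ℕ) : ℤ) +ᵥ x) =
      (((if x ∈ B then π else 1 : Perm (Fin n)) i : ℕ) : ℤ) +ᵥ x := by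
  split_ifs with h
  · exact towerHom_apply hB (hS.mono hBS) π i h
  · refine towerHom_apply_of_forall_ne π fun y hy j e => h ?_
    rw [← (hS.eq_of_vadd_eq (hBS hy) hx j.2 i.2 e).1]
    exact hy

/-- Inside a common tower, a column whose base point misses `U` or `V` sees at most one of the two
factors, so the commutator dies there. -/
theorem commutator_towerHom {S U V : Set X} (hS : IsTower n S) (hU : IsClopen U) (hV : IsClopen V)
    (hUS : U ⊆ S) (hVS : V ⊆ S) (π η : Perm (Fin n)) :
    towerHom n U π * towerHom n V η * (towerHom n U π)⁻¹ * (towerHom n V η)⁻¹ =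
      towerHom n (U ∩ V) (π * η * π⁻¹ * η⁻¹) := by
  classical
  rw [← map_inv, ← map_inv]
  refine fullGroup_ext fun z => ?_
  by_cases hz : ∀ x ∈ S, ∀ i : Fin n, ((i : ℕ) : ℤ) +ᵥ x ≠ z
  · have hU' : ∀ x ∈ U, ∀ i : Fin n, ((i : ℕ) : ℤ) +ᵥ x ≠ z := fun x hx => hz x (hUS hx)
    have hV' : ∀ x ∈ V, ∀ i : Fin n, ((i : ℕ) : ℤ) +ᵥ x ≠ z := fun x hx => hz x (hVS hx)
    simp only [fullGroup_mul_apply, towerHom_apply_of_forall_ne _ hU',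
      towerHom_apply_of_forall_ne _ hV']
    rw [towerHom_apply_of_forall_ne _ fun x hx => hU' x hx.1]
  · push Not at hz
    obtain ⟨x, hx, i, rfl⟩ := hz
    simp only [fullGroup_mul_apply, towerHom_apply_of_subset hS hU hUS _ _ hx,
      towerHom_apply_of_subset hS hV hVS _ _ hx,
      towerHom_apply_of_subset hS (hU.inter hV) (Set.inter_subset_left.trans hUS) _ _ hx]
    by_cases h1 : x ∈ U <;> by_cases h2 : x ∈ V <;> simp [h1, h2]

/-- The embedding of `Fin k` into `Fin n` starting at `s`. -/
def finShiftEmb {k n s : ℕ} (h : s + k ≤ n) : Fin k ↪ Fin n where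
  toFun i := ⟨s + i, by omega⟩
  inj' i j e := by
    simp only [Fin.mk.injEq, add_right_inj] at e
    exact Fin.ext e

/-- A permutation touching only the levels from `s` to `s + k - 1` does not see the others. This
allows the base to be translated, which links cylinders over different windows. -/
theorem towerHom_viaFintypeEmbedding {k s : ℕ} (h : s + k ≤ n) (hB : IsClopen B)
    (ht : IsTower n B) {C : Set X} (hC : IsClopen C) (hBC : ∀ y, (s : ℤ) +ᵥ y ∈ C ↔ y ∈ B)
    (π : Perm (Fin k)) :
    towerHom n B (π.viaFintypeEmbedding (finShiftEmb h)) = towerHom k C π := by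
  have htC : IsTower k C := (ht.of_le (by omega)).translate _ hBC
  refine towerHom_eq hC htC π (fun x hx i => ?_) fun z hz => ?_
  · obtain ⟨y, rfl⟩ : ∃ y, (s : ℤ) +ᵥ y = x := ⟨-(s : ℤ) +ᵥ x, vadd_neg_vadd _ _⟩
    have h1 (j : Fin k) : ((j : ℕ) : ℤ) +ᵥ ((s : ℤ) +ᵥ y) =
        ((finShiftEmb h j : ℕ) : ℤ) +ᵥ y := by
      rw [← add_vadd, add_comm, ← Nat.cast_add]
      rfl
    rw [h1, h1, towerHom_apply hB ht _ _ ((hBC y).1 hx), Perm.viaFintypeEmbedding_apply_image]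
  · by_cases hz' : ∀ x ∈ B, ∀ i : Fin n, ((i : ℕ) : ℤ) +ᵥ x ≠ z
    · exact towerHom_apply_of_forall_ne _ hz'
    · push Not at hz'
      obtain ⟨x, hx, i, rfl⟩ := hz'
      rw [towerHom_apply hB ht _ _ hx, Perm.viaFintypeEmbedding_apply_notMem_range]
      rintro ⟨j, rfl⟩
      refine hz ((s : ℤ) +ᵥ x) ((hBC x).2 hx) j ?_
      rw [← add_vadd, add_comm, ← Nat.cast_add]
      rfl

theorem towerHom_mem_commutator (hn : 5 ≤ n) {π : Perm (Fin n)} (hπ : Perm.sign π = 1) :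
    towerHom n B π ∈ commutator (fullGroup X) := by
  have h1 : π ∈ commutator (Perm (Fin n)) := by
    rw [alternatingGroup.commutator_perm_eq (by simpa using hn)]
    exact hπ
  have h2 := Subgroup.mem_map_of_mem (towerHom n B) h1
  rw [commutator_def, Subgroup.map_commutator] at h2
  exact Subgroup.commutator_mono le_top le_top h2

end Tower

/-! ### Generating alternating groups -/

section Perm

theorem alternatingGroup_le_of_conj_mem {α : Type*} [Fintype α] [DecidableEq α]
    (h5 : 5 ≤ Nat.card α) {H : Subgroup (Perm α)}
    (hH : ∀ π, Perm.sign π = 1 → ∀ η ∈ H, π * η * π⁻¹ ∈ H) {τ : Perm α} (hτ : Perm.sign τ = 1)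
    (hτ1 : τ ≠ 1) (hτH : τ ∈ H) : alternatingGroup α ≤ H := by
  have hn : (H.subgroupOf (alternatingGroup α)).Normal :=
    ⟨fun η hη π => hH π π.2 η hη⟩
  have := alternatingGroup.isSimpleGroup h5
  rcases hn.eq_bot_or_eq_top with h | h
  · have h1 : (⟨τ, hτ⟩ : alternatingGroup α) ∈ H.subgroupOf (alternatingGroup α) := hτH
    rw [h, Subgroup.mem_bot, Subtype.ext_iff] at h1
    exact absurd h1 hτ1
  · rwa [Subgroup.subgroupOf_eq_top] at h

theorem viaFintypeEmbedding_finRotate_three {k s : ℕ} (h : s + 3 ≤ k + 1) :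
    (finRotate 3).viaFintypeEmbedding (finShiftEmb h) =
      swap (⟨s, by omega⟩ : Fin k).castSucc (⟨s, by omega⟩ : Fin k).succ *
        swap (⟨s + 1, by omega⟩ : Fin k).castSucc (⟨s + 1, by omega⟩ : Fin k).succ := by
  have e : ∀ i, (finShiftEmb h i : ℕ) = s + i := fun i => rfl
  ext i
  by_cases hi : i ∈ Set.range (finShiftEmb h)
  · obtain ⟨j, rfl⟩ := hi
    rw [Perm.viaFintypeEmbedding_apply_image]
    have h2 : s ≠ s + 1 + 1 := by omega
    have h3 : s + 1 + 1 ≠ s := by omega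
    fin_cases j <;> simp [swap_apply_def, Fin.ext_iff, e, h2, h3]
  · rw [Perm.viaFintypeEmbedding_apply_notMem_range _ _ hi]
    have h0 : (i : ℕ) ≠ s := fun h0 => hi ⟨0, Fin.ext (by simp [e, h0])⟩
    have h1 : (i : ℕ) ≠ s + 1 := fun h0 => hi ⟨1, Fin.ext (by simp [e, h0])⟩
    have h2 : (i : ℕ) ≠ s + 1 + 1 := fun h0 => hi ⟨2, Fin.ext (by simp [e, h0])⟩
    simp [swap_apply_def, Fin.ext_iff, h0, h1, h2]

/-- The three-cycle at `s` is the product of the adjacent transpositions `t s` and `t (s + 1)`. Such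
products telescope to every `t i * t j`, and an even permutation is a word of even length in the `t
i`. -/
theorem alternatingGroup_le_of_finRotate_three {n : ℕ} {H : Subgroup (Perm (Fin n))}
    (hH : ∀ (s : ℕ) (h : s + 3 ≤ n), (finRotate 3).viaFintypeEmbedding (finShiftEmb h) ∈ H) :
    alternatingGroup (Fin n) ≤ H := by
  rcases n with _ | k
  · intro π _
    rw [Subsingleton.elim π 1]
    exact one_mem _
  let t : Fin k → Perm (Fin (k + 1)) := fun i => swap i.castSucc i.succ
  have ht : ∀ i, t i * t i = 1 := fun i => swap_mul_self _ _
  have h1 : ∀ (d a : ℕ) (h : a + d < k), t ⟨a, by omega⟩ * t ⟨a + d, h⟩ ∈ H := by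
    intro d
    induction d with
    | zero => intro a h; simp only [add_zero, ht]; exact one_mem _
    | succ d ih =>
      intro a h
      have h2 := hH (a + d) (by omega)
      rw [viaFintypeEmbedding_finRotate_three] at h2
      have h3 := mul_mem (ih a (by omega)) h2
      have h4 : t ⟨a, by omega⟩ * t ⟨a + d, by omega⟩ *
          (t ⟨a + d, by omega⟩ * t ⟨a + d + 1, h⟩) ∈ H := h3
      rwa [mul_assoc, ← mul_assoc (t ⟨a + d, _⟩), ht, one_mul] at h4
  have h2 : ∀ i j, t i * t j ∈ H := by
    intro i j
    rcases le_total i.1 j.1 with h | h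
    · have := h1 (j - i) i (by omega)
      simpa only [Nat.add_sub_cancel' h] using this
    · have := inv_mem (h1 (i - j) j (by omega))
      simp only [Nat.add_sub_cancel' h, mul_inv_rev] at this
      simpa [t] using this
  -- Odd permutations are carried along so that the induction can add one transposition at a time.
  have h3 : ∀ π : Perm (Fin (k + 1)), (Perm.sign π = 1 → π ∈ H) ∧
      (Perm.sign π = -1 → ∀ j, t j * π ∈ H) := by
    intro π
    have hπ : π ∈ Submonoid.closure (Set.range fun i : Fin k => swap i.castSucc i.succ) := by
      rw [Perm.mclosure_swap_castSucc_succ]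
      trivial
    induction hπ using Submonoid.closure_induction_left with
    | one =>
      refine ⟨fun _ => one_mem _, fun h => ?_⟩
      rw [map_one] at h
      exact absurd h (by decide)
    | mul_left τ hτ π _ ih =>
      obtain ⟨i, rfl⟩ := hτ
      have hs : Perm.sign (swap i.castSucc i.succ) = -1 :=
        Perm.sign_swap (Fin.castSucc_lt_succ).ne
      simp only [map_mul, hs]
      refine ⟨fun h => ih.2 ?_ i, fun h j => ?_⟩
      · rw [← h]; simp
      · rw [← mul_assoc]
        refine mul_mem (h2 j i) (ih.1 ?_)
        simpa using h
  exact fun π hπ => (h3 π).1 hπ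

end Perm

/-! ### The commutator trick: from two bases to their intersection -/

section Step

variable {X : Type*} [AddAction ℤ X] [TopologicalSpace X] [ContinuousConstVAdd ℤ X]
  [CompactSpace X]

/-- The permutations whose action over `U ∩ V` lies in `G` are closed under conjugation by even
ones, by commutators with elements over `U`. The three-cycle over `V` supplies a nontrivial element,
and simplicity of the alternating group finishes. -/
theorem towerHom_inter_mem {G : Subgroup (fullGroup X)} {S U V : Set X} (hS : IsTower 5 S)
    (hU : IsClopen U) (hV : IsClopen V) (hUS : U ⊆ S) (hVS : V ⊆ S)
    (hUG : ∀ π, Perm.sign π = 1 → towerHom 5 U π ∈ G)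
    (hVG : towerHom 5 V ((finRotate 3).viaFintypeEmbedding (finShiftEmb (s := 1) (by decide))) ∈ G)
    (π : Perm (Fin 5)) (hπ : Perm.sign π = 1) : towerHom 5 (U ∩ V) π ∈ G := by
  refine alternatingGroup_le_of_conj_mem (H := G.comap (towerHom 5 (U ∩ V))) (by simp)
    (fun σ hσ η hη => ?_) (τ := ?_) ?_ ?_ ?_ hπ
  · rw [Subgroup.mem_comap] at hη ⊢
    have h1 := commutator_towerHom hS hU (hU.inter hV) hUS (Set.inter_subset_left.trans hUS) σ η
    rw [← Set.inter_assoc, Set.inter_self] at h1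
    have h2 : towerHom 5 (U ∩ V) (σ * η * σ⁻¹) = towerHom 5 (U ∩ V) (σ * η * σ⁻¹ * η⁻¹) *
        towerHom 5 (U ∩ V) η := by
      rw [← map_mul, inv_mul_cancel_right]
    rw [h2, ← h1]
    have h3 := hUG σ hσ
    exact mul_mem (mul_mem (mul_mem (mul_mem h3 hη) (inv_mem h3)) (inv_mem hη)) hη
  -- This is a commutator of two three-cycles, on `0, 1, 4` and on `1, 2, 3`; it is nontrivial
  -- because they share exactly one level.
  · exact (swap 0 1 * swap 1 4) * ((finRotate 3).viaFintypeEmbedding (finShiftEmb (s := 1)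
      (by decide))) * (swap 0 1 * swap 1 4)⁻¹ *
      ((finRotate 3).viaFintypeEmbedding (finShiftEmb (s := 1) (by decide)))⁻¹
  · simp
  · rw [viaFintypeEmbedding_finRotate_three]
    decide
  · rw [Subgroup.mem_comap, ← commutator_towerHom hS hU hV hUS hVS]
    have h3 := hUG (swap 0 1 * swap 1 4) (by decide)
    exact mul_mem (mul_mem (mul_mem h3 hVG) (inv_mem h3)) (inv_mem hVG)

end Step

/-! ### Cutting a multisection permutation along a clopen partition -/

section Restrict

namespace Multisection

variable {X : Type*} [TopologicalSpace X] [AddAction ℤ X] {ι : Type*} {m : Multisection X ι}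

open Classical in
/-- The restriction of a family of permutations of the active indices to a clopen set. -/
noncomputable def restrict (p : m.perms) {B : Set X} (hB : IsClopen B) : m.perms :=
  ⟨fun x => if x ∈ B then p.1 x else 1,
    isLocallyConstant_ite hB p.2.1 (IsLocallyConstant.const 1), fun x i hi => by
      by_cases hx : x ∈ B
      · simp only [if_pos hx, p.2.2 x i hi]
      · simp only [if_neg hx, Perm.one_apply]⟩

theorem restrict_apply_of_mem (p : m.perms) {B : Set X} (hB : IsClopen B) {x : X} (hx : x ∈ B) :
    (restrict p hB).1 x = p.1 x := if_pos hx

theorem restrict_apply_of_notMem (p : m.perms) {B : Set X} (hB : IsClopen B) {x : X}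
    (hx : x ∉ B) : (restrict p hB).1 x = 1 := if_neg hx

variable [ContinuousConstVAdd ℤ X] [CompactSpace X] [Finite ι]

theorem hom_restrict_apply_of_forall_ne (p : m.perms) {B : Set X} (hB : IsClopen B) {z : X}
    (hz : ∀ x ∈ B, ∀ i ∈ m.active x, m.pos x i +ᵥ x ≠ z) :
    (m.hom (restrict p hB)).1 z = z := by
  by_cases h : ∀ x, ∀ i ∈ m.active x, m.pos x i +ᵥ x ≠ z
  · exact hom_apply_of_forall_ne _ h
  · push Not at h
    obtain ⟨x, i, hi, rfl⟩ := h
    have hx : x ∉ B := fun hx => hz x hx i hi rfl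
    rw [hom_apply _ hi, restrict_apply_of_notMem p hB hx, Perm.one_apply]

theorem hom_mem_of_fibers {D : Type*} [Finite D] {w : X → D} (hw : IsLocallyConstant w)
    (p : m.perms) {G : Subgroup (fullGroup X)}
    (h : ∀ x, m.hom (restrict p (hw.isClopen_fiber (w x))) ∈ G) : m.hom p ∈ G := by
  classical
  have := Fintype.ofFinite D
  have hcl : ∀ s : Finset D, IsClopen (w ⁻¹' s) := fun s => ⟨⟨hw (s : Set D)ᶜ⟩, hw s⟩
  have h1 : ∀ s : Finset D, m.hom (restrict p (hcl s)) ∈ G := by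
    intro s
    induction s using Finset.induction_on with
    | empty =>
      have : restrict p (hcl ∅) = 1 := Subtype.ext (funext fun x =>
        restrict_apply_of_notMem p _ (by simp))
      rw [this, map_one]
      exact one_mem G
    | insert a s ha ih =>
      have h2 : restrict p (hcl (insert a s)) =
          restrict p (hw.isClopen_fiber a) * restrict p (hcl s) := by
        refine Subtype.ext (funext fun x => ?_)
        change _ = (restrict p (hw.isClopen_fiber a)).1 x * (restrict p (hcl s)).1 x
        by_cases hx : w x = a
        · rw [restrict_apply_of_mem p _ (by simp [hx]), restrict_apply_of_mem p _ hx,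
            restrict_apply_of_notMem p _ (by simp [hx, ha]), mul_one]
        · rw [restrict_apply_of_notMem p (hw.isClopen_fiber a) hx, one_mul]
          by_cases hs : w x ∈ s
          · rw [restrict_apply_of_mem p _ (by simp [hs]), restrict_apply_of_mem p _ (by simpa)]
          · rw [restrict_apply_of_notMem p _ (by simp [hs, hx]),
              restrict_apply_of_notMem p _ (by simpa)]
      rw [h2, map_mul]
      refine mul_mem ?_ ih
      by_cases hr : ∃ x, w x = a
      · obtain ⟨x, rfl⟩ := hr
        exact h x
      · have : restrict p (hw.isClopen_fiber a) = 1 := Subtype.ext (funext fun x =>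
          restrict_apply_of_notMem p _ (fun hx => hr ⟨x, hx⟩))
        rw [this, map_one]
        exact one_mem G
  have h3 : restrict p (hcl Finset.univ) = p := Subtype.ext (funext fun x =>
    restrict_apply_of_mem p _ (by simp))
  rw [← h3]
  exact h1 _

end Multisection

end Restrict

/-! ### Cylinder sets and the finitely generated group of short cylinders -/

section Atom

variable {X C : Type*} [AddAction ℤ X]

/-- The points whose `κ`-itineraries agree with that of `x` at the times between `a` and `b`. -/
def atom (κ : X → C) (a b : ℤ) (x : X) : Set X :=
  {y | ∀ i, a ≤ i → i ≤ b → κ (i +ᵥ y) = κ (i +ᵥ x)}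

variable {κ : X → C}

theorem mem_atom_self (a b : ℤ) (x : X) : x ∈ atom κ a b x := fun _ _ _ => rfl

theorem atom_mono {a b a' b' : ℤ} (ha : a' ≤ a) (hb : b ≤ b') (x : X) :
    atom κ a' b' x ⊆ atom κ a b x :=
  fun _ hy i h1 h2 => hy i (ha.trans h1) (h2.trans hb)

theorem atom_inter {a b c d : ℤ} (hac : a ≤ c) (hcb : c ≤ b + 1) (hbd : b ≤ d) (x : X) :
    atom κ a b x ∩ atom κ c d x = atom κ a d x := by
  refine Set.Subset.antisymm ?_ fun y hy => ⟨atom_mono le_rfl hbd x hy, atom_mono hac le_rfl x hy⟩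
  rintro y ⟨h1, h2⟩ i hi hi'
  rcases le_or_gt i b with h | h
  · exact h1 i hi h
  · exact h2 i (by omega) hi'

theorem vadd_mem_atom (s a b : ℤ) (x y : X) :
    s +ᵥ y ∈ atom κ a b (s +ᵥ x) ↔ y ∈ atom κ (a + s) (b + s) x := by
  constructor
  · intro h i h1 h2
    have := h (i - s) (by omega) (by omega)
    rwa [← add_vadd, ← add_vadd, sub_add_cancel] at this
  · intro h i h1 h2
    rw [← add_vadd, ← add_vadd]
    exact h (i + s) (by omega) (by omega)

theorem isTower_of_ne {n : ℕ} (h : ∀ x, ∀ i : ℕ, 0 < i → i < n → κ ((i : ℤ) +ᵥ x) ≠ κ x)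
    {j a b : ℤ} (ha : a ≤ j) (hb : j ≤ b) (x : X) : IsTower n (atom κ a b x) := by
  intro y hy i h0 hi hiy
  refine h (j +ᵥ y) i h0 hi ?_
  rw [vadd_comm, hy j ha hb, hiy j ha hb]

variable [TopologicalSpace X] [ContinuousConstVAdd ℤ X]

theorem isClopen_atom (hκ : IsLocallyConstant κ) (a b : ℤ) (x : X) : IsClopen (atom κ a b x) := by
  have h : atom κ a b x = ⋂ i ∈ Set.Icc a b, {y | κ (i +ᵥ y) = κ (i +ᵥ x)} := by
    ext y
    simp [atom]
  rw [h]
  exact (Set.finite_Icc a b).isClopen_biInter fun i _ =>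
    (hκ.comp_continuous (continuous_const_vadd i)).isClopen_fiber _

variable [CompactSpace X]

/-- Pairs separated by a letter at a time of absolute value at most `L` form open sets increasing
with `L`; they cover the compact set `K`. -/
theorem exists_itinerary_ne (hκ : IsLocallyConstant κ)
    (hsep : ∀ x y : X, (∀ i : ℤ, κ (i +ᵥ x) = κ (i +ᵥ y)) → x = y) {K : Set (X × X)}
    (hK : IsClosed K) (hne : ∀ q ∈ K, q.1 ≠ q.2) :
    ∃ L : ℕ, ∀ q ∈ K, ∃ i : ℤ, -L ≤ i ∧ i ≤ L ∧ κ (i +ᵥ q.1) ≠ κ (i +ᵥ q.2) := by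
  let U : ℕ → Set (X × X) := fun L => ⋃ i ∈ Set.Icc (-L : ℤ) L,
    {q | κ (i +ᵥ q.1) ≠ κ (i +ᵥ q.2)}
  have hU : ∀ L, IsOpen (U L) := fun L => isOpen_biUnion fun i _ => by
    have h1 : IsLocallyConstant fun q : X × X => κ (i +ᵥ q.1) :=
      hκ.comp_continuous ((continuous_const_vadd i).comp continuous_fst)
    have h2 : IsLocallyConstant fun q : X × X => κ (i +ᵥ q.2) :=
      hκ.comp_continuous ((continuous_const_vadd i).comp continuous_snd)
    exact (h1.prodMk h2) {c | c.1 ≠ c.2}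
  have hmono : Monotone U := fun a b hab => Set.biUnion_subset_biUnion_left
    (Set.Icc_subset_Icc (by omega) (by omega))
  obtain ⟨L, hL⟩ := hK.isCompact.elim_directed_cover U hU (fun q hq => by
    by_contra h
    refine hne q hq (hsep _ _ fun i => ?_)
    by_contra hi
    refine h (Set.mem_iUnion.2 ⟨i.natAbs, Set.mem_biUnion (x := i) ?_ hi⟩)
    constructor <;> omega) hmono.directed_le
  refine ⟨L, fun q hq => ?_⟩
  obtain ⟨i, hi, hi'⟩ := Set.mem_iUnion₂.1 (hL hq)
  exact ⟨i, hi.1, hi.2, hi'⟩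

theorem exists_atom_const (hκ : IsLocallyConstant κ)
    (hsep : ∀ x y : X, (∀ i : ℤ, κ (i +ᵥ x) = κ (i +ᵥ y)) → x = y) {Y : Type*} {F : X → Y}
    (hF : IsLocallyConstant F) :
    ∃ L : ℕ, ∀ x, ∀ y ∈ atom κ (-L) L x, F y = F x := by
  have h1 : IsLocallyConstant fun q : X × X => F q.1 := hF.comp_continuous continuous_fst
  have h2 : IsLocallyConstant fun q : X × X => F q.2 := hF.comp_continuous continuous_snd
  have hK : IsClosed {q : X × X | F q.1 ≠ F q.2} := ⟨(h1.prodMk h2) {c | ¬ c.1 ≠ c.2}⟩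
  obtain ⟨L, hL⟩ := exists_itinerary_ne hκ hsep hK fun q hq h => hq (by rw [h])
  refine ⟨L, fun x y hy => ?_⟩
  by_contra h
  obtain ⟨i, h1, h2, h3⟩ := hL (y, x) h
  exact h3 (hy i h1 h2)

theorem exists_atom_isTower [T2Space X] (hfree : ∀ (n : ℤ) (x : X), n +ᵥ x = x → n = 0)
    (hκ : IsLocallyConstant κ)
    (hsep : ∀ x y : X, (∀ i : ℤ, κ (i +ᵥ x) = κ (i +ᵥ y)) → x = y) (n : ℕ) :
    ∃ L : ℕ, ∀ x, IsTower n (atom κ (-L) L x) := by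
  have hK : IsClosed (⋃ i ∈ Set.Ioo 0 n, {q : X × X | q.2 = (i : ℤ) +ᵥ q.1}) :=
    (Set.finite_Ioo 0 n).isClosed_biUnion fun i _ =>
      isClosed_eq continuous_snd ((continuous_const_vadd (i : ℤ)).comp continuous_fst)
  obtain ⟨L, hL⟩ := exists_itinerary_ne hκ hsep hK fun q hq h => by
    obtain ⟨i, hi, hi'⟩ := Set.mem_iUnion₂.1 hq
    have h1 : q.2 = (i : ℤ) +ᵥ q.1 := hi'
    rw [← h] at h1
    have := hfree _ _ h1.symm
    have := hi.1
    omega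
  refine ⟨L, fun x y hy i h0 hi hiy => ?_⟩
  obtain ⟨j, h1, h2, h3⟩ := hL (y, (i : ℤ) +ᵥ y)
    (Set.mem_biUnion (x := i) (by exact ⟨h0, hi⟩) rfl)
  exact h3 ((hy j h1 h2).trans (hiy j h1 h2).symm)

/-- The subgroup generated by the alternating groups of the towers of height five over the atoms
of length two. -/
def atomGroup (κ : X → C) : Subgroup (fullGroup X) :=
  Subgroup.closure (Set.range fun q : X × alternatingGroup (Fin 5) =>
    towerHom 5 (atom κ 0 1 q.1) q.2)

theorem atomGroup_fg [Finite C] (κ : X → C) : (atomGroup κ).FG := by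
  rw [Subgroup.fg_iff]
  refine ⟨_, rfl, (Set.finite_range fun q : (C × C) × alternatingGroup (Fin 5) =>
    towerHom 5 {y : X | κ ((0 : ℤ) +ᵥ y) = q.1.1 ∧ κ ((1 : ℤ) +ᵥ y) = q.1.2} q.2).subset ?_⟩
  rintro _ ⟨⟨x, π⟩, rfl⟩
  refine ⟨((κ ((0 : ℤ) +ᵥ x), κ ((1 : ℤ) +ᵥ x)), π), ?_⟩
  have h : {y : X | κ ((0 : ℤ) +ᵥ y) = κ ((0 : ℤ) +ᵥ x) ∧ κ ((1 : ℤ) +ᵥ y) = κ ((1 : ℤ) +ᵥ x)} =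
      atom κ 0 1 x := by
    ext y
    refine ⟨fun hy i h0 h1 => ?_, fun hy => ⟨hy 0 le_rfl zero_le_one, hy 1 zero_le_one le_rfl⟩⟩
    obtain rfl | rfl : i = 0 ∨ i = 1 := by omega
    exacts [hy.1, hy.2]
  simp only [h]

/-- The window grows one letter at a time, first to the right, then to the left; a left and a right
window are then intersected. The distinct-letter hypothesis makes a single-letter cylinder a tower
of height five containing all bases involved. -/
theorem towerHom_atom_mem (hκ : IsLocallyConstant κ)
    (h5 : ∀ x : X, ∀ i : ℕ, 0 < i → i < 5 → κ ((i : ℤ) +ᵥ x) ≠ κ x) {a b : ℤ} (ha : a ≤ 0)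
    (hb : 1 ≤ b) (x : X) (π : Perm (Fin 5)) (hπ : Perm.sign π = 1) :
    towerHom 5 (atom κ a b x) π ∈ atomGroup κ := by
  have hcl := isClopen_atom hκ
  have base : ∀ (x : X) (π : Perm (Fin 5)), Perm.sign π = 1 →
      towerHom 5 (atom κ 0 1 x) π ∈ atomGroup κ :=
    fun x π hπ => Subgroup.subset_closure ⟨(x, ⟨π, hπ⟩), rfl⟩
  have sgn : ∀ (s : ℕ) (h : s + 3 ≤ 5),
      Perm.sign ((finRotate 3).viaFintypeEmbedding (finShiftEmb h)) = 1 := by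
    intro s h
    rw [Perm.viaFintypeEmbedding_sign]
    decide
  have right : ∀ (c : ℕ) (x : X) (π : Perm (Fin 5)), Perm.sign π = 1 →
      towerHom 5 (atom κ 0 (1 + c) x) π ∈ atomGroup κ := by
    intro c
    induction c with
    | zero => simpa using base
    | succ c ih =>
      intro x π hπ
      have e := atom_inter (κ := κ) (a := 0) (b := 1 + c) (c := 1) (d := 1 + (c + 1 : ℕ))
        (by omega) (by omega) (by omega) x
      rw [← e]
      refine towerHom_inter_mem (isTower_of_ne h5 (j := 1) le_rfl le_rfl x) (hcl _ _ _) (hcl _ _ _)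
        (atom_mono (by omega) (by omega) x) (atom_mono (by omega) (by omega) x) (ih x) ?_ π hπ
      -- Levels 1, 2, 3 over the window from `1` to `2 + c` at `x` are levels 0, 1, 2 over the
      -- window from `0` to `1 + c` at `1 +ᵥ x`, which the induction covers.
      have h1 := ih ((1 : ℤ) +ᵥ x) _ (sgn 0 (by omega))
      rw [towerHom_viaFintypeEmbedding _ (hcl _ _ _) (isTower_of_ne h5 le_rfl (by omega) _)
        (hcl _ _ _) (fun y => by rw [Nat.cast_zero, zero_vadd])] at h1
      rwa [towerHom_viaFintypeEmbedding _ (hcl _ _ _) (isTower_of_ne h5 le_rfl (by omega) _)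
        (hcl _ _ _)]
      intro y
      rw [Nat.cast_one, vadd_mem_atom]
      have e2 : 1 + (c : ℤ) + 1 = 1 + (c + 1 : ℕ) := by omega
      rw [e2, zero_add]
  have left : ∀ (c : ℕ) (x : X) (π : Perm (Fin 5)), Perm.sign π = 1 →
      towerHom 5 (atom κ (-c) 1 x) π ∈ atomGroup κ := by
    intro c
    induction c with
    | zero => simpa using base
    | succ c ih =>
      intro x π hπ
      have e := atom_inter (κ := κ) (a := -(c + 1 : ℕ)) (b := 0) (c := -c) (d := 1)
        (by omega) (by omega) (by omega) x
      rw [← e, Set.inter_comm]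
      refine towerHom_inter_mem (isTower_of_ne h5 (j := 0) le_rfl le_rfl x) (hcl _ _ _) (hcl _ _ _)
        (atom_mono (by omega) (by omega) x) (atom_mono (by omega) (by omega) x) (ih x) ?_ π hπ
      -- Here the base moves the other way: levels 1, 2, 3 over the window from `-(c + 1)` to `0` at
      -- `x` are levels 2, 3, 4 over the window from `-c` to `1` at `-1 +ᵥ x`.
      have h1 := ih ((-1 : ℤ) +ᵥ x) _ (sgn 2 (by omega))
      have hcl' : IsClopen ((fun y : X => (-1 : ℤ) +ᵥ y) ⁻¹' atom κ (-(c + 1 : ℕ)) 0 x) :=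
        (hcl _ _ _).preimage (continuous_const_vadd _)
      rw [towerHom_viaFintypeEmbedding _ (hcl _ _ _) (isTower_of_ne h5 le_rfl (by omega) _)
        hcl'] at h1
      · rwa [towerHom_viaFintypeEmbedding _ (hcl _ _ _) (isTower_of_ne h5 le_rfl (by omega) _)
          hcl']
        intro y
        rw [Nat.cast_one, Set.mem_preimage, neg_vadd_vadd]
      · intro y
        obtain ⟨y, rfl⟩ : ∃ w, (-1 : ℤ) +ᵥ w = y := ⟨(1 : ℤ) +ᵥ y, neg_vadd_vadd _ _⟩
        rw [Set.mem_preimage, vadd_mem_atom, ← add_vadd, ← add_vadd]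
        have e2 : -(c : ℤ) + -1 = -(c + 1 : ℕ) := by omega
        rw [e2]
        norm_num
  obtain ⟨c, rfl⟩ : ∃ c : ℕ, a = -c := ⟨a.natAbs, by omega⟩
  obtain ⟨d, rfl⟩ : ∃ d : ℕ, b = 1 + d := ⟨(b - 1).natAbs, by omega⟩
  have e := atom_inter (κ := κ) (a := -c) (b := 1) (c := 0) (d := 1 + d)
        (by omega) (by omega) (by omega) x
  rw [← e]
  refine towerHom_inter_mem (isTower_of_ne h5 (j := 0) le_rfl le_rfl x) (hcl _ _ _) (hcl _ _ _)
    (atom_mono (by omega) (by omega) x) (atom_mono (by omega) (by omega) x) (left c x)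
    (right d x _ (sgn 1 (by omega))) π hπ

end Atom

/-! ### Even multisection permutations lie in the group of short cylinders -/

section Placement

theorem exists_perm_of_injOn {ι β : Type*} [Fintype ι] [DecidableEq ι] [Fintype β] [DecidableEq β]
    {E : Set ι} (e : E → β) (he : Function.Injective e) (π : Perm ι)
    (hπ : ∀ i ∉ E, π i = i) :
    ∃ η : Perm β, Perm.sign η = Perm.sign π ∧ (∀ (i : E) (h : π i ∈ E), η (e i) = e ⟨π i, h⟩) ∧
      ∀ b ∉ Set.range e, η b = b := by
  classical
  have hE : ∀ i, π i ∈ E ↔ i ∈ E := by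
    intro i
    constructor
    · intro h
      by_contra hi
      rw [hπ i hi] at h
      exact hi h
    · intro h
      by_contra hi
      have := π.injective (hπ _ hi)
      rw [this] at hi
      exact hi h
  refine ⟨(π.subtypePerm (p := (· ∈ E)) hE).viaFintypeEmbedding ⟨e, he⟩, ?_, fun i h => ?_,
    fun b hb => Perm.viaFintypeEmbedding_apply_notMem_range _ _ hb⟩
  · rw [Perm.viaFintypeEmbedding_sign, Perm.sign_subtypePerm]
    intro i hi
    by_contra h
    exact hi (hπ i h)
  · exact Perm.viaFintypeEmbedding_apply_image _ ⟨e, he⟩ i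

variable {X C : Type*} [AddAction ℤ X] [TopologicalSpace X] [ContinuousConstVAdd ℤ X]
  [CompactSpace X]

namespace Multisection

variable {k : ℕ} {m : Multisection X (Fin k)}

/-- Over `W` the multisection is constant, so it sits inside a tower of height `2 * L + 1`: index
`i` occupies level `m.pos x₀ i + L`, and the base is moved back by `L` to make levels nonnegative.
-/
theorem exists_hom_restrict_eq_towerHom
    (p : m.perms) {W : Set X} (hW : IsClopen W) {L : ℕ}
    (hL : ∀ x i, m.pos x i ∈ Set.Icc (-L : ℤ) L)
    (hTW : IsTower (2 * L + 1) W) {x₀ : X} (hc : ∀ x ∈ W, m.active x = m.active x₀ ∧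
      m.pos x = m.pos x₀ ∧ p.1 x = p.1 x₀) :
    ∃ π : Perm (Fin (2 * L + 1)), Perm.sign π = Perm.sign (p.1 x₀) ∧
      m.hom (restrict p hW) = towerHom (2 * L + 1) ((fun y : X => (L : ℤ) +ᵥ y) ⁻¹' W) π := by
  have hpos : ∀ i, 0 ≤ m.pos x₀ i + L ∧ m.pos x₀ i + L < (2 * L + 1 : ℕ) := fun i => by
    obtain ⟨h1, h2⟩ := hL x₀ i
    constructor
    · linarith
    · push_cast
      linarith
  let e : m.active x₀ → Fin (2 * L + 1) := fun i => ⟨(m.pos x₀ i + L).toNat, by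
    have := hpos i
    omega⟩
  have hev : ∀ i, ((e i : ℕ) : ℤ) = m.pos x₀ i + L := fun i => Int.toNat_of_nonneg (hpos i).1
  have he : Function.Injective e := by
    intro i j hij
    have h1 : m.pos x₀ i = m.pos x₀ j := by
      have := hev i
      rw [hij, hev j] at this
      linarith
    exact Subtype.ext (m.inj i.2 j.2 (by rw [h1])).2
  obtain ⟨π, hs, h1, h2⟩ := exists_perm_of_injOn e he (p.1 x₀) (p.2.2 x₀)
  have hlev : ∀ (y : X) (i : m.active x₀), ((e i : ℕ) : ℤ) +ᵥ y =
      m.pos x₀ i +ᵥ ((L : ℤ) +ᵥ y) := fun y i => by rw [hev, add_vadd]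
  refine ⟨π, hs, towerHom_eq (hW.preimage (continuous_const_vadd _))
    (hTW.translate (-L) fun y => by rw [Set.mem_preimage, vadd_neg_vadd]) π
    (fun y hy j => ?_) fun z hz => ?_⟩
  · obtain ⟨ha, hb, hcc⟩ := hc _ hy
    by_cases hj : j ∈ Set.range e
    · obtain ⟨i, rfl⟩ := hj
      have hi : (i : Fin k) ∈ m.active ((L : ℤ) +ᵥ y) := by
        rw [ha]
        exact i.2
      have hi' := perms_apply_mem p.2 i.2
      rw [h1 i hi', hlev, hlev, ← hb, hom_apply _ hi, restrict_apply_of_mem p hW hy, hcc]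
    · rw [h2 j hj]
      refine hom_restrict_apply_of_forall_ne p hW fun x hx i hi hxi => hj ?_
      obtain ⟨ha', hb', -⟩ := hc _ hx
      rw [ha'] at hi
      obtain ⟨w, rfl⟩ : ∃ w, (L : ℤ) +ᵥ w = x := ⟨-(L : ℤ) +ᵥ x, vadd_neg_vadd _ _⟩
      have h3 := hlev w ⟨i, hi⟩
      rw [hb'] at hxi
      rw [hxi] at h3
      have h4 : ((e ⟨i, hi⟩ : ℕ) : ℤ) +ᵥ ((L : ℤ) +ᵥ w) = ((j : ℕ) : ℤ) +ᵥ ((L : ℤ) +ᵥ y) := by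
        rw [vadd_comm, h3, vadd_comm]
      exact ⟨⟨i, hi⟩, Fin.ext (hTW.eq_of_vadd_eq hx hy (e _).2 j.2 h4).2⟩
  · refine hom_restrict_apply_of_forall_ne p hW fun x hx i hi hxi => ?_
    obtain ⟨ha', hb', -⟩ := hc _ hx
    rw [ha'] at hi
    obtain ⟨w, rfl⟩ : ∃ w, (L : ℤ) +ᵥ w = x := ⟨-(L : ℤ) +ᵥ x, vadd_neg_vadd _ _⟩
    refine hz w hx (e ⟨i, hi⟩) ?_
    rw [hlev, ← hxi, hb']

end Multisection

variable {κ : X → C}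

/-- It suffices to treat consecutive three-cycles. The one at level `s` acts over the base
translated by `s`, whose window still contains the times `0` and `1`, so it extends to height five.
-/
theorem towerHom_atom_mem_of_sign (hκ : IsLocallyConstant κ)
    (h5 : ∀ x : X, ∀ i : ℕ, 0 < i → i < 5 → κ ((i : ℤ) +ᵥ x) ≠ κ x) {n : ℕ} {a b : ℤ}
    (ha : a ≤ 0) (hb : 1 + n ≤ b) {x : X} (ht : IsTower n (atom κ a b x)) {π : Perm (Fin n)}
    (hπ : Perm.sign π = 1) : towerHom n (atom κ a b x) π ∈ atomGroup κ := by
  refine alternatingGroup_le_of_finRotate_three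
    (H := (atomGroup κ).comap (towerHom n (atom κ a b x))) (fun s hs => ?_) hπ
  have hcl := isClopen_atom hκ
  have h1 := towerHom_atom_mem hκ h5 (a := a - s) (b := b - s) (by omega) (by omega)
    ((s : ℤ) +ᵥ x) ((finRotate 3).viaFintypeEmbedding (finShiftEmb (s := 0) (by decide)))
    (by rw [Perm.viaFintypeEmbedding_sign]; decide)
  rw [towerHom_viaFintypeEmbedding _ (hcl _ _ _)
    (isTower_of_ne h5 (j := 0) (by omega) (by omega) _) (hcl _ _ _)
    (fun y => by rw [Nat.cast_zero, zero_vadd])] at h1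
  rw [Subgroup.mem_comap, towerHom_viaFintypeEmbedding hs (hcl _ _ _) ht (hcl _ _ _)]
  · exact h1
  · intro y
    rw [vadd_mem_atom, sub_add_cancel, sub_add_cancel]

theorem altFullGroup_le_atomGroup [Finite C] [T2Space X]
    (hfree : ∀ (n : ℤ) (x : X), n +ᵥ x = x → n = 0) (hκ : IsLocallyConstant κ)
    (hsep : ∀ x y : X, (∀ i : ℤ, κ (i +ᵥ x) = κ (i +ᵥ y)) → x = y)
    (h5 : ∀ x : X, ∀ i : ℕ, 0 < i → i < 5 → κ ((i : ℤ) +ᵥ x) ≠ κ x) :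
    altFullGroup X ≤ atomGroup κ := by
  rw [altFullGroup, Subgroup.closure_le]
  rintro _ ⟨k, m, p, hp, rfl⟩
  obtain ⟨L, hL⟩ := m.exists_pos_bound
  obtain ⟨L₁, h1⟩ := exists_atom_const hκ hsep
    (m.isLocallyConstant_active.prodMk (m.isLocallyConstant_pos.prodMk p.2.1))
  obtain ⟨L₂, h2⟩ := exists_atom_isTower hfree hκ hsep (2 * L + 1)
  -- Large enough that, even after the shift by `L`, the window contains the one giving a tower and
  -- the times from `0` to `2 * L + 2`.
  let R : ℕ := L₁ + L₂ + 3 * L + 2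
  let w : X → (Set.Icc (-R : ℤ) R → C) := fun x i => κ ((i : ℤ) +ᵥ x)
  have hw : IsLocallyConstant w := by
    rw [IsLocallyConstant.iff_eventually_eq]
    intro x
    have : ∀ᶠ y in 𝓝 x, ∀ i : Set.Icc (-R : ℤ) R, κ ((i : ℤ) +ᵥ y) = κ ((i : ℤ) +ᵥ x) := by
      rw [Filter.eventually_all]
      exact fun i => (hκ.comp_continuous (continuous_const_vadd (i : ℤ))).eventually_eq x
    filter_upwards [this] with y hy
    exact funext hy
  refine Multisection.hom_mem_of_fibers hw p fun x => ?_
  have hwx : {y | w y = w x} = atom κ (-R) R x := by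
    ext y
    exact ⟨fun h i h1 h2 => congrFun h ⟨i, h1, h2⟩, fun h => funext fun i => h i i.2.1 i.2.2⟩
  have hT : IsTower (2 * L + 1) {y | w y = w x} := by
    rw [hwx]
    exact (h2 x).mono (atom_mono (by omega) (by omega) x)
  obtain ⟨π, hπ, h⟩ := Multisection.exists_hom_restrict_eq_towerHom p
    (hw.isClopen_fiber (w x)) hL hT (x₀ := x) (fun y hy => by
      rw [hwx] at hy
      have := h1 x y (atom_mono (by omega) (by omega) x hy)
      simpa only [Prod.mk.injEq] using this)
  have hB : (fun y : X => (L : ℤ) +ᵥ y) ⁻¹' {y | w y = w x} =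
      atom κ (-R + L) (R + L) (-(L : ℤ) +ᵥ x) := by
    ext y
    rw [hwx, Set.mem_preimage, ← vadd_mem_atom, vadd_neg_vadd]
  rw [hB] at h
  rw [h]
  refine towerHom_atom_mem_of_sign hκ h5 (by omega) (by omega) ?_ (by rw [hπ, hp])
  exact (h2 _).mono (atom_mono (by omega) (by omega) _)

end Placement

/-! ### Extending partial injections evenly, and locally constant choices -/

section Extend

theorem exists_perm_extend_sign {α : Type*} [Fintype α] [DecidableEq α] {s : Set α} {f : α → α}
    (hf : Set.InjOn f s) {a b : α} (hab : a ≠ b) (ha : a ∉ s) (hb : b ∉ s) :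
    ∃ π : Perm α, Perm.sign π = 1 ∧ ∀ i ∈ s, π i = f i := by
  obtain ⟨g, hg⟩ := Set.MapsTo.exists_equiv_extend_of_card_eq (t := Finset.univ) (s := s) (f := f)
    rfl (fun _ _ => Finset.mem_coe.2 (Finset.mem_univ _)) hf
  let π : Perm α := g.trans (Equiv.subtypeUnivEquiv Finset.mem_univ)
  have hπ : ∀ i ∈ s, π i = f i := hg
  rcases Int.units_eq_one_or (Perm.sign π) with h | h
  · exact ⟨π, h, hπ⟩
  -- Swapping two points outside `s` repairs the sign without changing the values on `s`.
  · refine ⟨π * swap a b, by rw [map_mul, h, Perm.sign_swap hab]; rfl, fun i hi => ?_⟩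
    rw [Perm.mul_apply, swap_apply_of_ne_of_ne, hπ i hi]
    · rintro rfl; exact ha hi
    · rintro rfl; exact hb hi

end Extend

/-- The choice is made from the predicate `R x` alone, so it is as locally constant as `R`. -/
theorem isLocallyConstant_choose {X T : Type*} [TopologicalSpace X] [Inhabited T] {R : X → T → Prop}
    (hR : ∀ x, ∀ᶠ y in 𝓝 x, R y = R x) (h : ∀ x, ∃ π, R x π) :
    ∃ p : X → T, IsLocallyConstant p ∧ ∀ x, R x (p x) := by
  classical
  let F : (T → Prop) → T := fun S => if h : ∃ π, S π then h.choose else default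
  have hF : ∀ S : T → Prop, (∃ π, S π) → S (F S) := fun S hS => by
    simp only [F, dif_pos hS]
    exact hS.choose_spec
  exact ⟨fun x => F (R x), ((IsLocallyConstant.iff_eventually_eq R).2 hR).comp F,
    fun x => hF _ (h x)⟩

/-! ### Return times and the displacement argument -/

section Return

variable {X : Type*} [AddAction ℤ X]

/-- The indices below `M` and below the return time to `Z`. -/
def belowReturn (M : ℕ) (Z : Set X) (x : X) : Set (Fin M) :=
  {i | x ∈ Z ∧ ∀ j : ℕ, 0 < j → j ≤ i → (j : ℤ) +ᵥ x ∉ Z}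

theorem belowReturn_congr {M R : ℕ} {Z : Set X} {x y : X} (hR : M ≤ R)
    (h : ∀ j : ℕ, j ≤ R → ((j : ℤ) +ᵥ y ∈ Z ↔ (j : ℤ) +ᵥ x ∈ Z)) :
    belowReturn M Z y = belowReturn M Z x := by
  ext i
  have h0 := h 0 (Nat.zero_le _)
  rw [Nat.cast_zero, zero_vadd, zero_vadd] at h0
  refine and_congr h0 (forall_congr' fun j => forall_congr' fun _ => forall_congr' fun hj => ?_)
  exact not_congr (h j (by omega))

theorem belowReturn_aux {M : ℕ} {Z : Set X} {x y : X} {i j : Fin M} (hi : i ∈ belowReturn M Z x)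
    (hj : j ∈ belowReturn M Z y) (hij : i ≤ j)
    (e : ((i : ℕ) : ℤ) +ᵥ x = ((j : ℕ) : ℤ) +ᵥ y) : x = y ∧ i = j := by
  have e' : x = ((j - i : ℕ) : ℤ) +ᵥ y := by
    rw [← vadd_left_cancel_iff ((i : ℕ) : ℤ), e, ← add_vadd]
    congr 1
    omega
  rcases Nat.eq_zero_or_pos (j - i : ℕ) with h0 | h0
  · rw [h0, Nat.cast_zero, zero_vadd] at e'
    exact ⟨e', by omega⟩
  · exact absurd (e' ▸ hi.1) (hj.2 _ h0 (by omega))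

variable [TopologicalSpace X]

theorem fullGroup_mul_comm_of_disjoint {f g : fullGroup X}
    (h : ∀ z, f.1 z = z ∨ g.1 z = z) : f * g = g * f := by
  have h1 : Perm.Disjoint f.1.toEquiv g.1.toEquiv := h
  exact fullGroup_ext fun z => Equiv.congr_fun h1.commute.eq z

theorem exists_cocycle_bound [CompactSpace X] (f : fullGroup X) :
    ∃ (n : X → ℤ) (N : ℕ), IsLocallyConstant n ∧ (∀ x, f.1 x = n x +ᵥ x) ∧
      ∀ x, -N ≤ n x ∧ n x ≤ N := by
  obtain ⟨n, hn, hf⟩ := fullGroup_exists_cocycle f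
  have h1 : IsLocallyConstant fun x => (n x).natAbs := hn.comp Int.natAbs
  obtain ⟨N, hN⟩ := h1.range_finite.bddAbove
  refine ⟨n, N, hn, hf, fun x => ?_⟩
  have : (n x).natAbs ≤ N := hN ⟨x, rfl⟩
  omega

/-- Levels at distance at least `N` from both ends of the column over `x` are moved by `f` within
that column. This partial injection, together with the identity on inactive indices, extends to an
even permutation. -/
theorem exists_perm_belowReturn (hfree : ∀ (n : ℤ) (x : X), n +ᵥ x = x → n = 0) {Z : Set X}
    {M N : ℕ} (hM : ∀ x, ∃ j : ℕ, 0 < j ∧ j ≤ M ∧ (j : ℤ) +ᵥ x ∈ Z) (hN : 2 ≤ N)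
    (hT : IsTower 2 Z) (f : fullGroup X) {n : X → ℤ} (hf : ∀ x, f.1 x = n x +ᵥ x)
    (hn : ∀ x, -N ≤ n x ∧ n x ≤ N) (x : X) :
    ∃ π : Perm (Fin M), Perm.sign π = 1 ∧ (∀ i ∉ belowReturn M Z x, π i = i) ∧
      ∀ i : Fin M, x ∈ Z → N ≤ i → (∀ j : ℕ, 0 < j → j ≤ i + N → (j : ℤ) +ᵥ x ∉ Z) →
        ((π i : ℕ) : ℤ) = n (((i : ℕ) : ℤ) +ᵥ x) + (i : ℕ) := by
  classical
  by_cases hx : x ∈ Z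
  swap
  · exact ⟨1, map_one _, fun i _ => rfl, fun i hi => absurd hi hx⟩
  obtain ⟨j₀, h0, hjM, hj₀⟩ := hM x
  have hj2 : 2 ≤ j₀ := by
    by_contra h
    obtain rfl : j₀ = 1 := by omega
    exact hT x hx 1 one_pos one_lt_two hj₀
  let core : Set (Fin M) := {i | N ≤ i ∧ ∀ j : ℕ, 0 < j → j ≤ i + N → (j : ℤ) +ᵥ x ∉ Z}
  let t : Fin M → ℤ := fun i => n (((i : ℕ) : ℤ) +ᵥ x) + (i : ℕ)
  have ht : ∀ i ∈ core, 0 ≤ t i ∧ t i < M ∧ t i ≤ i + N := by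
    intro i hi
    obtain ⟨h1, h2⟩ := hn (((i : ℕ) : ℤ) +ᵥ x)
    have h3 : i + N < j₀ := by
      by_contra h
      exact hi.2 j₀ h0 (by omega) hj₀
    have h4 := hi.1
    simp only [t]
    refine ⟨?_, ?_, ?_⟩ <;> omega
  let F : Fin M → Fin M := fun i => if h : i ∈ core then ⟨(t i).toNat, by
    have := ht i h
    omega⟩ else i
  have hF : ∀ i ∈ core, ((F i : ℕ) : ℤ) = t i := by
    intro i hi
    simp only [F, dif_pos hi]
    exact Int.toNat_of_nonneg (ht i hi).1
  have hF' : ∀ i ∉ core, F i = i := fun i hi => dif_neg hi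
  have hFa : ∀ i ∈ core, F i ∈ belowReturn M Z x := by
    intro i hi
    refine ⟨hx, fun j hj hji => hi.2 j hj ?_⟩
    have h1 := hF i hi
    have h2 := ht i hi
    omega
  have hcoreF : Set.InjOn F (core ∪ (belowReturn M Z x)ᶜ) := by
    intro i hi j hj hij
    by_cases hic : i ∈ core <;> by_cases hjc : j ∈ core
    · have h1 : t i = t j := by rw [← hF i hic, ← hF j hjc, hij]
      have h2 : ∀ i : Fin M, f.1 (((i : ℕ) : ℤ) +ᵥ x) = t i +ᵥ x := fun i => by
        rw [hf, ← add_vadd]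
      have h3 : ((i : ℕ) : ℤ) +ᵥ x = ((j : ℕ) : ℤ) +ᵥ x :=
        f.1.injective (by rw [h2, h2, h1])
      have h4 := hfree (-((j : ℕ) : ℤ) + (i : ℕ)) x (by rw [add_vadd, h3, neg_vadd_vadd])
      omega
    · have h1 := hFa i hic
      rw [hij, hF' j hjc] at h1
      exact absurd h1 (hj.resolve_left hjc)
    · have h1 := hFa j hjc
      rw [← hij, hF' i hic] at h1
      exact absurd h1 (hi.resolve_left hic)
    · rwa [hF' i hic, hF' j hjc] at hij
  -- Levels 0 and 1 are free for the parity correction: `N ≥ 2` keeps them out of the core, and a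
  -- return time of at least two makes them active.
  have h0mem : ∀ (i : Fin M), (i : ℕ) < 2 → i ∉ core ∪ (belowReturn M Z x)ᶜ := by
    rintro i hi (h | h)
    · have := h.1
      omega
    · refine h ⟨hx, fun j hj hji => hT x hx j hj (by omega)⟩
  obtain ⟨π, hπ, hπF⟩ := exists_perm_extend_sign hcoreF (a := ⟨0, by omega⟩)
    (b := ⟨1, by omega⟩) (by simp) (h0mem _ (by simp)) (h0mem _ (by simp))
  refine ⟨π, hπ, fun i hi => ?_, fun i _ h1 h2 => ?_⟩
  · rw [hπF i (Or.inr hi), hF']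
    exact fun hc => hi ⟨hx, fun j hj hji => hc.2 j hj (by omega)⟩
  · have hc : i ∈ core := ⟨h1, h2⟩
    rw [hπF i (Or.inl hc), hF i hc]

variable [ContinuousConstVAdd ℤ X]

theorem eventually_forall_le_mem_iff {Z : Set X} (hZ : IsClopen Z) (R : ℕ) (x : X) :
    ∀ᶠ y in 𝓝 x, ∀ j : ℕ, j ≤ R → ((j : ℤ) +ᵥ y ∈ Z ↔ (j : ℤ) +ᵥ x ∈ Z) := by
  have h : ∀ᶠ y in 𝓝 x, ∀ j ∈ Set.Iic R, ((j : ℤ) +ᵥ y ∈ Z ↔ (j : ℤ) +ᵥ x ∈ Z) := by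
    rw [Filter.eventually_all_finite (Set.finite_Iic R)]
    intro j _
    have hcl := hZ.preimage (continuous_const_vadd (j : ℤ))
    by_cases hx : (j : ℤ) +ᵥ x ∈ Z
    · filter_upwards [hcl.isOpen.mem_nhds hx] with y hy using iff_of_true hy hx
    · filter_upwards [hcl.compl.isOpen.mem_nhds hx] with y hy using iff_of_false hy hx
  exact h

/-- The Kakutani-Rokhlin partition over the clopen set `Z`, truncated at height `M`. -/
def returnMultisection (M : ℕ) {Z : Set X} (hZ : IsClopen Z) : Multisection X (Fin M) where
  active := belowReturn M Z
  pos _ i := (i : ℕ)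
  isLocallyConstant_active := by
    rw [IsLocallyConstant.iff_eventually_eq]
    intro x
    filter_upwards [eventually_forall_le_mem_iff hZ M x] with y hy
    exact belowReturn_congr le_rfl hy
  isLocallyConstant_pos := IsLocallyConstant.const _
  inj {x y i j} hi hj e := by
    rcases le_total i j with h | h
    · exact belowReturn_aux hi hj h e
    · have := belowReturn_aux hj hi h e.symm
      exact ⟨this.1.symm, this.2.symm⟩

variable [CompactSpace X]

theorem exists_return_bound [hmin : AddAction.IsMinimal ℤ X] {Z : Set X} (hZ : IsOpen Z)
    (hne : Z.Nonempty) :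
    ∃ M : ℕ, ∀ x, ∃ j : ℕ, 0 < j ∧ j ≤ M ∧ (j : ℤ) +ᵥ x ∈ Z := by
  let U : ℕ → Set X := fun L => ⋃ i ∈ Set.Icc (-L : ℤ) L, (fun x => i +ᵥ x) ⁻¹' Z
  have hU : ∀ L, IsOpen (U L) := fun L => isOpen_biUnion fun i _ =>
    hZ.preimage (continuous_const_vadd i)
  have hmono : Monotone U := fun a b hab => Set.biUnion_subset_biUnion_left
    (Set.Icc_subset_Icc (by omega) (by omega))
  obtain ⟨L, hL⟩ := isCompact_univ.elim_directed_cover U hU (fun x _ => by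
    obtain ⟨_, ⟨i, rfl⟩, hi⟩ := (hmin.dense_orbit x).exists_mem_open hZ hne
    refine Set.mem_iUnion.2 ⟨i.natAbs, Set.mem_biUnion (x := i) ?_ hi⟩
    constructor <;> omega) hmono.directed_le
  -- Starting from `(L + 1) +ᵥ x` turns a visit at a time in `[-L, L]` into one at a time in `[1, 2
  -- * L + 1]`.
  refine ⟨2 * L + 1, fun x => ?_⟩
  obtain ⟨i, hi, hi'⟩ := Set.mem_iUnion₂.1 (hL (Set.mem_univ (((L + 1 : ℕ) : ℤ) +ᵥ x)))
  have h1 := hi.1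
  have h2 := hi.2
  refine ⟨(i + (L + 1 : ℕ)).toNat, by omega, by omega, ?_⟩
  rw [Int.toNat_of_nonneg (by omega), add_vadd]
  exact hi'

/-- A point away from the translates of `Z` near time zero lies deep inside its column, where the
permutation of `exists_perm_belowReturn` agrees with `f`. -/
theorem exists_altFullGroup_eq_off [AddAction.IsMinimal ℤ X]
    (hfree : ∀ (n : ℤ) (x : X), n +ᵥ x = x → n = 0) {Z : Set X} (hZ : IsClopen Z)
    (hne : Z.Nonempty) {N : ℕ} (hN : 2 ≤ N) (hT : IsTower 2 Z) (f : fullGroup X) {n : X → ℤ}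
    (hnc : IsLocallyConstant n) (hf : ∀ x, f.1 x = n x +ᵥ x) (hn : ∀ x, -N ≤ n x ∧ n x ≤ N) :
    ∃ a ∈ altFullGroup X, ∀ z, (∀ i : ℤ, -N ≤ i → i < N → -i +ᵥ z ∉ Z) → a.1 z = f.1 z := by
  obtain ⟨M, hM⟩ := exists_return_bound hZ.isOpen hne
  have hR := exists_perm_belowReturn hfree hM hN hT f hf hn
  obtain ⟨p, hp, hpR⟩ : ∃ p : X → Perm (Fin M), IsLocallyConstant p ∧ _ := by
    refine isLocallyConstant_choose (fun x => ?_) hR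
    have h1 : ∀ᶠ y in 𝓝 x, ∀ i : Fin M,
        n (((i : ℕ) : ℤ) +ᵥ y) = n (((i : ℕ) : ℤ) +ᵥ x) := by
      rw [Filter.eventually_all]
      exact fun i => (hnc.comp_continuous (continuous_const_vadd ((i : ℕ) : ℤ))).eventually_eq x
    filter_upwards [h1, eventually_forall_le_mem_iff hZ (M + N) x] with y h1 h2
    have h3 := h2 0 (Nat.zero_le _)
    rw [Nat.cast_zero, zero_vadd, zero_vadd] at h3
    have h4 : ∀ i : Fin M, (∀ j : ℕ, 0 < j → j ≤ i + N → (j : ℤ) +ᵥ y ∉ Z) ↔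
        (∀ j : ℕ, 0 < j → j ≤ i + N → (j : ℤ) +ᵥ x ∉ Z) := fun i =>
      forall_congr' fun j => forall_congr' fun _ => forall_congr' fun hj =>
        not_congr (h2 j (by omega))
    funext π
    simp only [belowReturn_congr (Nat.le_add_right M N) h2, h1, h3, h4]
  let m := returnMultisection M hZ
  let P : m.perms := ⟨p, hp, fun x => (hpR x).2.1⟩
  refine ⟨m.hom P, m.hom_mem_altFullGroup P fun x => (hpR x).1, fun z hz => ?_⟩
  have hback : ∃ i : ℕ, -(i : ℤ) +ᵥ z ∈ Z := by
    obtain ⟨j, h0, h1, h2⟩ := hM (-(M : ℤ) +ᵥ z)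
    refine ⟨M - j, ?_⟩
    rw [← add_vadd] at h2
    convert h2 using 2
    omega
  classical
  -- The time since the last visit to `Z`, that is, the level of `z` in its column.
  let i := Nat.find hback
  have hi : -(i : ℤ) +ᵥ z ∈ Z := Nat.find_spec hback
  have hi' : ∀ k : ℤ, k < i → -N ≤ k → -k +ᵥ z ∉ Z := by
    intro k hk hk'
    rcases lt_or_ge k N with h | h
    · exact hz k hk' h
    · have h1 := Nat.find_min hback (m := k.toNat) (by omega)
      rwa [Int.toNat_of_nonneg (by omega)] at h1
  have hlev : ∀ j : ℕ, 0 < j → j ≤ i + N → (j : ℤ) +ᵥ (-(i : ℤ) +ᵥ z) ∉ Z := by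
    intro j h0 h1
    rw [← add_vadd]
    convert hi' (i - j) (by omega) (by omega) using 2
    rw [neg_sub, sub_eq_add_neg]
  have hNi : N ≤ i := by
    by_contra h
    exact hz i (by omega) (by omega) hi
  have hiM : i < M := by
    obtain ⟨j, h0, h1, h2⟩ := hM (-(i : ℤ) +ᵥ z)
    by_contra h
    exact hlev j h0 (by omega) h2
  have hact : (⟨i, hiM⟩ : Fin M) ∈ m.active (-(i : ℤ) +ᵥ z) :=
    ⟨hi, fun j h0 h1 => hlev j h0 (by
      simp only at h1
      omega)⟩
  have h1 := Multisection.hom_apply P hact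
  have h2 := (hpR (-(i : ℤ) +ᵥ z)).2.2 ⟨i, hiM⟩ hi hNi hlev
  have h3 : m.pos (-(i : ℤ) +ᵥ z) ⟨i, hiM⟩ +ᵥ (-(i : ℤ) +ᵥ z) = z := vadd_neg_vadd _ _
  rw [h3] at h1
  rw [h1, hf]
  change ((p (-(i : ℤ) +ᵥ z) ⟨i, hiM⟩ : ℕ) : ℤ) +ᵥ (-(i : ℤ) +ᵥ z) = _
  rw [h2, add_vadd]
  simp only [vadd_neg_vadd]

/-- Modulo `altFullGroup X`, both `f` and `g` are supported on the `2 * N` translates around `Z`. An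
even tower permutation pushes one support off the other, so their classes commute. -/
theorem commutator_le_altFullGroup [AddAction.IsMinimal ℤ X]
    (hfree : ∀ (n : ℤ) (x : X), n +ᵥ x = x → n = 0)
    (hZ : ∀ n, ∃ Z : Set X, IsClopen Z ∧ Z.Nonempty ∧ IsTower n Z) :
    commutator (fullGroup X) ≤ altFullGroup X := by
  rw [commutator_def, Subgroup.commutator_le]
  rintro f - g -
  obtain ⟨n, N₁, hn, hf, hnN⟩ := exists_cocycle_bound f
  obtain ⟨l, N₂, hl, hg, hlN⟩ := exists_cocycle_bound g
  obtain ⟨N, h1N, h2N, hN⟩ : ∃ N, N₁ ≤ N ∧ N₂ ≤ N ∧ 2 ≤ N :=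
    ⟨N₁ + N₂ + 2, by omega, by omega, by omega⟩
  obtain ⟨Z, hZc, hZne, hT⟩ := hZ (4 * N)
  obtain ⟨a, ha, haf⟩ := exists_altFullGroup_eq_off hfree hZc hZne hN (hT.of_le (by omega)) f hn hf
    fun x => by
      have := hnN x
      omega
  obtain ⟨b, hb, hbg⟩ := exists_altFullGroup_eq_off hfree hZc hZne hN (hT.of_le (by omega)) g hl hg
    fun x => by
      have := hlN x
      omega
  -- Moving the base back by `N` makes the possible support the lower half of a tower of height `4 *
  -- N`; `s` will carry it to the upper half.
  let B : Set X := (fun y => (N : ℤ) +ᵥ y) ⁻¹' Z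
  have hB : IsClopen B := hZc.preimage (continuous_const_vadd _)
  have hBT : IsTower (4 * N) B :=
    hT.translate (-N) fun y => by rw [Set.mem_preimage, vadd_neg_vadd]
  let F : Fin (4 * N) → Fin (4 * N) := fun i => if h : (i : ℕ) < 2 * N then
    ⟨i + 2 * N, by omega⟩ else i
  have hF : ∀ i : Fin (4 * N), (i : ℕ) < 2 * N → (F i : ℕ) = i + 2 * N := fun i hi => by
    simp only [F, dif_pos hi]
  obtain ⟨π, hπ, hπF⟩ := exists_perm_extend_sign (s := {i : Fin (4 * N) | (i : ℕ) < 2 * N})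
    (f := F) (fun i hi j hj hij => by
      have h1 := hF i hi
      have h2 := hF j hj
      rw [hij] at h1
      omega) (a := ⟨2 * N, by omega⟩) (b := ⟨2 * N + 1, by omega⟩) (by simp) (by simp) (by simp)
  let s := towerHom (4 * N) B π
  have hs : s ∈ altFullGroup X := towerHom_mem_altFullGroup hπ
  have hlev : ∀ z, (∃ i : ℤ, -N ≤ i ∧ i < N ∧ -i +ᵥ z ∈ Z) →
      ∃ y ∈ B, ∃ i : Fin (4 * N), (i : ℕ) < 2 * N ∧ ((i : ℕ) : ℤ) +ᵥ y = z := by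
    rintro z ⟨i, h1, h2, h3⟩
    refine ⟨-(N : ℤ) +ᵥ (-i +ᵥ z), ?_, ⟨(i + N).toNat, by omega⟩, by simp only; omega, ?_⟩
    · rw [Set.mem_preimage, vadd_neg_vadd]
      exact h3
    · simp only
      rw [Int.toNat_of_nonneg (by omega), add_vadd, vadd_neg_vadd, vadd_neg_vadd]
  have hcomm : (a⁻¹ * f) * (s * (b⁻¹ * g) * s⁻¹) = (s * (b⁻¹ * g) * s⁻¹) * (a⁻¹ * f) := by
    refine fullGroup_mul_comm_of_disjoint fun z => ?_
    by_cases h1 : ∃ i : ℤ, -N ≤ i ∧ i < N ∧ -i +ᵥ z ∈ Z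
    · right
      by_cases h2 : ∃ i : ℤ, -N ≤ i ∧ i < N ∧ -i +ᵥ (s⁻¹).1 z ∈ Z
      · exfalso
        obtain ⟨y, hy, i, hi, hiy⟩ := hlev _ h1
        obtain ⟨w, hw, j, hj, hjw⟩ := hlev _ h2
        have h3 : s.1 (((j : ℕ) : ℤ) +ᵥ w) = z := by rw [hjw, fullGroup_apply_inv_apply]
        rw [towerHom_apply hB hBT π j hw, ← hiy] at h3
        have h4 := (hBT.eq_of_vadd_eq hw hy (π j).2 i.2 h3).2
        rw [hπF j hj, hF j hj] at h4
        omega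
      · push Not at h2
        rw [fullGroup_mul_apply, fullGroup_mul_apply, fullGroup_mul_apply, ← hbg _ h2,
          fullGroup_inv_apply_apply, fullGroup_apply_inv_apply]
    · left
      push Not at h1
      rw [fullGroup_mul_apply, ← haf z h1, fullGroup_inv_apply_apply]
  -- In the quotient `a`, `b` and `s` become trivial, leaving that `f` and `g` commute.
  have hcomm' := congrArg (QuotientGroup.mk' (altFullGroup X)) hcomm
  rw [← QuotientGroup.ker_mk' (altFullGroup X)] at ha hb hs ⊢
  rw [MonoidHom.mem_ker] at ha hb hs ⊢
  simp only [map_mul, map_inv, ha, hb, hs, inv_one, one_mul, mul_one] at hcomm'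
  rw [map_commutatorElement, commutatorElement_eq_one_iff_mul_comm]
  exact hcomm'

end Return

/-! ### Transitivity, finite generation and freeness -/

section Main

variable {X : Type*} [AddAction ℤ X] [TopologicalSpace X] [ContinuousConstVAdd ℤ X]
  [CompactSpace X]

theorem exists_mem_commutator_forall_apply_eq {x : X}
    (hx : ∀ n, ∃ B : Set X, IsClopen B ∧ x ∈ B ∧ IsTower n B) {k : ℕ} {a b : Fin k → ℤ}
    (ha : Function.Injective a) (hb : Function.Injective b) :
    ∃ g ∈ commutator (fullGroup X), ∀ i, g.1 (a i +ᵥ x) = b i +ᵥ x := by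
  classical
  obtain ⟨L, hL⟩ : ∃ L : ℕ, ∀ i, (a i).natAbs ≤ L ∧ (b i).natAbs ≤ L := by
    obtain ⟨L, hL⟩ := (Set.finite_range fun i => (a i).natAbs + (b i).natAbs).bddAbove
    refine ⟨L, fun i => ?_⟩
    have : (a i).natAbs + (b i).natAbs ≤ L := hL ⟨i, rfl⟩
    omega
  -- The positions in `[-L, L]` fill `2 * L + 1` levels; the excess leaves two spare levels for
  -- parity and ensures a height of at least five.
  obtain ⟨B, hB, hxB, hT⟩ := hx (2 * L + 7)
  let C : Set X := (fun y => (L : ℤ) +ᵥ y) ⁻¹' B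
  have hC : IsClopen C := hB.preimage (continuous_const_vadd _)
  have hCT : IsTower (2 * L + 7) C :=
    hT.translate (-L) fun y => by rw [Set.mem_preimage, vadd_neg_vadd]
  let u : Fin k → Fin (2 * L + 7) := fun i => ⟨(a i + L).toNat, by have := hL i; omega⟩
  let v : Fin k → Fin (2 * L + 7) := fun i => ⟨(b i + L).toNat, by have := hL i; omega⟩
  have hu : ∀ i, ((u i : ℕ) : ℤ) = a i + L := fun i =>
    Int.toNat_of_nonneg (by have := hL i; omega)
  have hv : ∀ i, ((v i : ℕ) : ℤ) = b i + L := fun i =>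
    Int.toNat_of_nonneg (by have := hL i; omega)
  have hui : Function.Injective u := fun i j h => ha (by
    have h1 := hu i
    rw [h, hu j] at h1
    omega)
  have hvi : Function.Injective v := fun i j h => hb (by
    have h1 := hv i
    rw [h, hv j] at h1
    omega)
  have hlt : ∀ i, (u i : ℕ) < 2 * L + 1 := fun i => by
    have := hL i
    have := hu i
    omega
  let F : Fin (2 * L + 7) → Fin (2 * L + 7) := Function.extend u v id
  have hF : ∀ i, F (u i) = v i := fun i => hui.extend_apply v id i
  obtain ⟨π, hπ, hπF⟩ := exists_perm_extend_sign (s := Set.range u) (f := F) (by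
      rintro _ ⟨i, rfl⟩ _ ⟨j, rfl⟩ h
      rw [hF, hF] at h
      rw [hvi h]) (a := ⟨2 * L + 1, by omega⟩) (b := ⟨2 * L + 2, by omega⟩) (by simp)
    (by
      rintro ⟨i, hi⟩
      have := hlt i
      rw [hi] at this
      simp at this)
    (by
      rintro ⟨i, hi⟩
      have := hlt i
      rw [hi] at this
      simp at this)
  refine ⟨towerHom (2 * L + 7) C π, towerHom_mem_commutator (by omega) hπ, fun i => ?_⟩
  have h1 := towerHom_apply hC hCT π (u i) (x := -(L : ℤ) +ᵥ x)
    (by rw [Set.mem_preimage, vadd_neg_vadd]; exact hxB)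
  rwa [hπF _ ⟨i, rfl⟩, hF, hu, hv, add_vadd, add_vadd, vadd_neg_vadd] at h1

variable {A : Type*} {κ : X → A}

theorem commutator_fullGroup_fg [Finite A] [T2Space X] [Nonempty X] [AddAction.IsMinimal ℤ X]
    (hfree : ∀ (n : ℤ) (x : X), n +ᵥ x = x → n = 0) (hκ : IsLocallyConstant κ)
    (hsep : ∀ x y : X, (∀ i : ℤ, κ (i +ᵥ x) = κ (i +ᵥ y)) → x = y) :
    (commutator (fullGroup X)).FG := by
  -- The higher block code `w` on this window gives distinct symbols at any five consecutive times.
  obtain ⟨L, hL⟩ := exists_atom_isTower hfree hκ hsep 5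
  let w : X → (Set.Icc (-L : ℤ) L → A) := fun x i => κ ((i : ℤ) +ᵥ x)
  have hw : IsLocallyConstant w := by
    rw [IsLocallyConstant.iff_eventually_eq]
    intro x
    have : ∀ᶠ y in 𝓝 x, ∀ i : Set.Icc (-L : ℤ) L, κ ((i : ℤ) +ᵥ y) = κ ((i : ℤ) +ᵥ x) := by
      rw [Filter.eventually_all]
      exact fun i => (hκ.comp_continuous (continuous_const_vadd (i : ℤ))).eventually_eq x
    filter_upwards [this] with y hy
    exact funext hy
  have hwsep : ∀ x y : X, (∀ i : ℤ, w (i +ᵥ x) = w (i +ᵥ y)) → x = y := fun x y h =>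
    hsep x y fun i => by
      have h0 := congrFun (h i) ⟨0, by simp⟩
      simpa only [w, zero_vadd] using h0
  have hw5 : ∀ x : X, ∀ i : ℕ, 0 < i → i < 5 → w ((i : ℤ) +ᵥ x) ≠ w x :=
    fun x i h0 h5 h => hL x x (mem_atom_self _ _ x) i h0 h5
      fun j h1 h2 => congrFun h ⟨j, h1, h2⟩
  have h1 : commutator (fullGroup X) ≤ altFullGroup X := by
    refine commutator_le_altFullGroup hfree fun n => ?_
    obtain ⟨R, hR⟩ := exists_atom_isTower hfree hκ hsep n
    let x : X := Classical.arbitrary X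
    exact ⟨_, isClopen_atom hκ _ _ x, ⟨x, mem_atom_self _ _ x⟩, hR x⟩
  have h2 : altFullGroup X ≤ atomGroup w := altFullGroup_le_atomGroup hfree hw hwsep hw5
  have h3 : atomGroup w ≤ commutator (fullGroup X) := by
    rw [atomGroup, Subgroup.closure_le]
    rintro _ ⟨q, rfl⟩
    exact towerHom_mem_commutator le_rfl q.2.2
  rw [le_antisymm (h1.trans h2) h3]
  exact atomGroup_fg w

/-- A periodic orbit is finite, hence closed; being dense, it would be the whole infinite space. -/
theorem eq_zero_of_vadd_eq_of_isMinimal {Y : Type*} [TopologicalSpace Y] [T1Space Y]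
    [AddAction ℤ Y] [Infinite Y] [hmin : AddAction.IsMinimal ℤ Y] (n : ℤ) (x : Y)
    (h : n +ᵥ x = x) : n = 0 := by
  by_contra hn
  have h1 : AddAction.orbit ℤ x ⊆ (fun m : ℤ => m +ᵥ x) '' Set.Icc 0 |n| := by
    rintro _ ⟨m, rfl⟩
    refine ⟨m % n, ⟨Int.emod_nonneg _ hn, (Int.emod_lt_abs _ hn).le⟩, ?_⟩
    have h2 : (m / n) • n ∈ AddAction.stabilizer ℤ x :=
      zsmul_mem (show n ∈ AddAction.stabilizer ℤ x from h) _
    have h3 : m % n + (m / n) • n = m := by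
      rw [smul_eq_mul, mul_comm]
      exact Int.emod_add_mul_ediv m n
    change (m % n) +ᵥ x = m +ᵥ x
    conv_rhs => rw [← h3, add_vadd, AddAction.mem_stabilizer_iff.1 h2]
  have h2 : (AddAction.orbit ℤ x).Finite := ((Set.finite_Icc _ _).image _).subset h1
  have h3 := (hmin.dense_orbit x).closure_eq
  rw [h2.isClosed.closure_eq] at h3
  exact Set.infinite_univ (h3 ▸ h2)

end Main

/-! ### Application to subshifts -/

theorem continuousConstVAdd_subshift {A : Type*} [TopologicalSpace A] (X : Subshift A ℤ) :
    ContinuousConstVAdd ℤ X.carrier where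
  continuous_const_vadd n := by
    refine Continuous.subtype_mk (continuous_pi fun i => ?_) _
    exact (continuous_apply (n + i)).comp continuous_subtype_val

theorem mainTheorem11 {A : Type*} [Finite A] [TopologicalSpace A] [DiscreteTopology A]
    (X : Subshift A ℤ) (hinf : X.carrier.Infinite) (hmin : AddAction.IsMinimal ℤ X.carrier) :
    (∀ x : X.carrier, (AddAction.orbit ℤ x).Countable ∧
      ∀ f ∈ topologicalFullGroup X, f '' AddAction.orbit ℤ x = AddAction.orbit ℤ x) ∧
    Group.FG (commutator (topologicalFullGroup X)) ∧
    ∀ (x : X.carrier) (k : ℕ),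
      MulAction.IsMultiplyPretransitive (commutator (topologicalFullGroup X))
        (AddAction.orbit ℤ x) k := by
  have := continuousConstVAdd_subshift X
  have : CompactSpace X.carrier := isCompact_iff_compactSpace.1 X.isClosed.isCompact
  have : Infinite X.carrier := hinf.to_subtype
  have hfree := eq_zero_of_vadd_eq_of_isMinimal (Y := X.carrier)
  have hκ : IsLocallyConstant fun x : X.carrier => x.1 0 :=
    (IsLocallyConstant.iff_continuous _).2 ((continuous_apply 0).comp continuous_subtype_val)
  have hsep : ∀ x y : X.carrier, (∀ i : ℤ, (i +ᵥ x).1 0 = (i +ᵥ y).1 0) → x = y := by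
    intro x y h
    refine Subtype.ext (funext fun i => ?_)
    have := h i
    rwa [subshift_vadd_apply, subshift_vadd_apply, add_zero] at this
  refine ⟨fun x => ⟨Set.countable_range _, fun f hf => ?_⟩, ?_, fun x k => ⟨fun y z => ?_⟩⟩
  · refine Set.Subset.antisymm ?_ fun y hy => ?_
    · rintro _ ⟨y, hy, rfl⟩
      exact topologicalFullGroup_apply_mem_orbit X hf x hy
    · exact ⟨f⁻¹ y, topologicalFullGroup_apply_mem_orbit X (inv_mem hf) x hy,
        f.apply_symm_apply y⟩
  -- `topologicalFullGroup X` and `fullGroup X.carrier` agree by definition, so the abstract results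
  -- apply directly.
  · exact (Group.fg_iff_subgroup_fg _).2 (commutator_fullGroup_fg hfree hκ hsep)
  · have htower : ∀ n, ∃ B : Set X.carrier, IsClopen B ∧ x ∈ B ∧ IsTower n B := fun n => by
      obtain ⟨R, hR⟩ := exists_atom_isTower hfree hκ hsep n
      exact ⟨_, isClopen_atom hκ _ _ x, mem_atom_self _ _ x, hR x⟩
    choose a ha using fun i => (y i).2
    choose b hb using fun i => (z i).2
    have ha' : ∀ i, a i +ᵥ x = (y i).1 := ha
    have hb' : ∀ i, b i +ᵥ x = (z i).1 := hb
    obtain ⟨g, hg, hgab⟩ := exists_mem_commutator_forall_apply_eq htower (a := a) (b := b)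
      (fun i j h => y.injective (Subtype.ext (by rw [← ha', ← ha', h])))
      (fun i j h => z.injective (Subtype.ext (by rw [← hb', ← hb', h])))
    refine ⟨⟨g, hg⟩, DFunLike.ext _ _ fun i => Subtype.ext ?_⟩
    change g.1 (y i).1 = (z i).1
    rw [← ha', ← hb', hgab]
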